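/- Let $K$ be a field of characteristic $0$ containing an element $t$ transcendental over $\mathbb Q$ (for example $K=\mathbb Q(t)$ or $\mathbb Q(q,t)$), and let $\Lambda$ be the ring of symmetric functions in infinitely many variables with coefficients in $K$ (symmetric formal power series of bounded degree). Let $p_r$ and $h_r$ be the power sums and complete symmetric functions ($h_r=0$ for $r<0$), let $\langle\cdot,\cdot\rangle$ be the Hall scalar product $\langle p_\lambda,p_\mu\rangle=\delta_{\lambda\mu}z_\lambda$, let $f^\perp$ be the adjoint of multiplication by $f$, and let $f\mapsto f[X(t-1)]$ be the $K$-algebra endomorphism of $\Lambda$ with $p_r\mapsto (t^r-1)p_r$. For $\ell\in\mathbb Z$ let $$B_\ell=\sum_{i\ge 0}h_{i+\ell}\,\bigl(h_i[X(t-1)]\bigr)^\perp ,$$ and for a partition $\lambda=(\lambda_1\ge\dots\ge\lambda_m>0)$ let $H_\lambda[X;t]=B_{\lambda_1}\cdots B_{\lambda_m}\cdot 1$ be the (modified) Hall–Littlewood function and $$B_\lambda=\prod_{1\le i<j\le m}(1-te_{ij})\,B_{\lambda_1}\cdots B_{\lambda_m},$$ where $e_{ij}$ raises the $i$-th index by one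 and lowers the $j$-th index by one. Fix $k\in\mathbb N$. A partition is $k$-bounded if all its parts are at most $k$; let $\Lambda^{(k)}_t$ be the $K$-span of the $H_\lambda[X;t]$ with $\lambda$ $k$-bounded. The $k$-split of a $k$-bounded $\lambda$ is the sequence $(\lambda^{(1)},\dots,\lambda^{(r)})$ of partitions obtained by cutting $\lambda$ into consecutive blocks, such that the main hook length (first part plus number of parts minus one) of $\lambda^{(i)}$ equals $k$ for $i<r$ and is at most $k$ for $i=r$. Put $G^{(k)}_\lambda[X;t]=B_{\lambda^{(1)}}\cdots B_{\lambda^{(r)}}\cdot 1$ (the $k$-split polynomials). **Theorem.** 1. The $G^{(k)}_\lambda[X;t]$, $\lambda$ $k$-bounded, form a basis of $\Lambda^{(k)}_t$, and $B_j$ maps $\Lambda^{(k)}_t$ to itself for every integer $j\le k$. Hence there is a well-defined linear projection $\bar T^{(k)}_j$ of $\Lambda^{(k)}_t$ with $\bar T^{(k)}_jG^{(k)}_\mu=G^{(k)}_\mu$ if $\mu_1=j$ and $\bar T^{(k)}_jG^{(k)}_\mu=0$ otherwise, and the $k$-Schur functions $s^{(k)}_\lambda[X;t]$ are well defined by $s^{(k)}_{()}=1$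 and $s^{(k)}_\lambda=\bar T^{(k)}_{\lambda_1}B_{\lambda_1}s^{(k)}_{(\lambda_2,\lambda_3,\dots)}$. 2. The $k$-Schur functions $s^{(k)}_\lambda[X;t]$, $\lambda$ $k$-bounded, form a basis of $\Lambda^{(k)}_t$. 3. For every $k$-bounded $\lambda$, $$s^{(k)}_\lambda[X;t]=G^{(k)}_\lambda[X;t]+\sum_{\mu}u^{(k)}_{\mu\lambda}(t)\,G^{(k)}_\mu[X;t],\qquad u^{(k)}_{\mu\lambda}(t)\in\mathbb Z[t],$$ where the sum is over the $k$-bounded partitions $\mu>\lambda$ (strict dominance order) with $\mu_1=\lambda_1$. -/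

import Mathlib

noncomputable section

namespace KSchur

open MvPowerSeries

/-- The ring `Λ` of symmetric functions in infinitely many variables `x₀, x₁, …` over the field
`K`: the formal power series of bounded degree that are invariant under permutations of the
variables. -/
def SymFun (K : Type*) [Field K] : Subalgebra K (MvPowerSeries ℕ K) where
  carrier := {f | (∀ σ : Equiv.Perm ℕ, rename σ f = f) ∧
    ∃ d : ℕ, ∀ m : ℕ →₀ ℕ, d < m.degree → coeff m f = 0}
  mul_mem' := by
    rintro f g ⟨hf, df, hdf⟩ ⟨hg, dg, hdg⟩
    refine ⟨fun σ => by rw [map_mul, hf, hg], df + dg, fun m hm => ?_⟩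
    classical
    rw [coeff_mul]
    refine Finset.sum_eq_zero fun p hp => ?_
    rw [Finset.HasAntidiagonal.mem_antidiagonal] at hp
    have : p.1.degree + p.2.degree = m.degree := by rw [← hp, map_add]
    rcases Nat.lt_or_ge df p.1.degree with h | h
    · rw [hdf _ h, zero_mul]
    · rw [hdg _ (by omega), mul_zero]
  add_mem' := by
    rintro f g ⟨hf, df, hdf⟩ ⟨hg, dg, hdg⟩
    refine ⟨fun σ => by rw [map_add, hf, hg], df + dg, fun m hm => ?_⟩
    rw [map_add, hdf _ (by omega), hdg _ (by omega), add_zero]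
  algebraMap_mem' := by
    intro r
    refine ⟨fun σ => AlgHom.commutes _ r, 0, fun m hm => ?_⟩
    classical
    have h0 : m ≠ 0 := by rintro rfl; simp at hm
    rw [MvPowerSeries.algebraMap_apply, coeff_C, if_neg h0]

theorem coeff_rename_perm {K : Type*} [Field K] (σ : Equiv.Perm ℕ) (f : MvPowerSeries ℕ K)
    (m : ℕ →₀ ℕ) : coeff (m.mapDomain σ) (rename σ f) = coeff m f := by
  have := coeff_embDomain_rename σ.toEmbedding f m
  rwa [Finsupp.embDomain_eq_mapDomain] at this

theorem rename_perm_eq {K : Type*} [Field K] (f : MvPowerSeries ℕ K)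
    (h : ∀ (σ : Equiv.Perm ℕ) (m : ℕ →₀ ℕ), coeff (m.mapDomain σ) f = coeff m f)
    (σ : Equiv.Perm ℕ) : rename σ f = f := by
  ext m
  obtain ⟨m, rfl⟩ : ∃ m', m = Finsupp.mapDomain σ m' :=
    ⟨m.mapDomain σ.symm, by rw [← Finsupp.mapDomain_comp]; simp⟩
  rw [coeff_rename_perm, h]

open Classical in
/-- The power sum `p_n = ∑ i, x_i ^ n` (used for `n ≥ 1`). -/
def psum (K : Type*) [Field K] (n : ℕ) : SymFun K :=
  ⟨fun m => if ∃ i, m = Finsupp.single i n then 1 else 0, by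
    refine ⟨rename_perm_eq _ fun σ m => ?_, n, fun m hm => ?_⟩
    · change (if _ then (1 : K) else 0) = if _ then 1 else 0
      congr 1
      refine propext ⟨?_, ?_⟩
      · rintro ⟨i, hi⟩
        refine ⟨σ.symm i, Finsupp.mapDomain_injective σ.injective ?_⟩
        rw [hi, Finsupp.mapDomain_single, Equiv.apply_symm_apply]
      · rintro ⟨i, rfl⟩
        exact ⟨σ i, Finsupp.mapDomain_single⟩
    · refine if_neg ?_
      rintro ⟨i, rfl⟩
      simp at hm⟩

/-- The complete symmetric function `h_n`, the sum of all monomials of degree `n`. -/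
def hsum (K : Type*) [Field K] (n : ℕ) : SymFun K :=
  ⟨fun m => if m.degree = n then 1 else 0, by
    refine ⟨rename_perm_eq _ fun σ m => ?_, n, fun m hm => if_neg hm.ne'⟩
    change (if _ then (1 : K) else 0) = if _ then 1 else 0
    rw [Finsupp.degree_mapDomain]⟩

theorem injective_of_surjective_end {R : Type*} [CommRing R] [IsNoetherianRing R] (φ : R →+* R)
    (hφ : Function.Surjective φ) : Function.Injective φ := by
  have hs : ∀ n, Function.Surjective (φ ^ n : R →+* R) := fun n => by
    rw [RingHom.coe_pow]; exact hφ.iterate n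
  let c : ℕ →o Ideal R := ⟨fun n => RingHom.ker (φ ^ n : R →+* R), by
    refine monotone_nat_of_le_succ fun n x hx => ?_
    rw [RingHom.mem_ker] at hx ⊢
    rw [pow_succ', RingHom.mul_def, RingHom.comp_apply, hx, map_zero]⟩
  obtain ⟨N, hN⟩ := monotone_stabilizes_iff_noetherian.mpr (inferInstance : IsNoetherianRing R) c
  rw [injective_iff_map_eq_zero]
  intro x hx
  obtain ⟨y, rfl⟩ := hs N x
  have h1 : y ∈ c (N + 1) := by
    change y ∈ RingHom.ker (φ ^ (N + 1) : R →+* R)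
    rw [RingHom.mem_ker, pow_succ', RingHom.mul_def, RingHom.comp_apply, hx]
  rw [← hN (N + 1) (Nat.le_succ N)] at h1
  exact h1

theorem esymm_mem_adjoin_psum (K : Type*) [Field K] [CharZero K] (n : ℕ) :
    ∀ k, k ≤ n → MvPolynomial.esymm (Fin n) K k ∈
      (MvPolynomial.aeval (R := K) fun i : Fin n =>
        MvPolynomial.psum (Fin n) K (i + 1)).range := by
  intro k
  induction k using Nat.strong_induction_on with
  | _ k ih =>
    intro hk
    rcases Nat.eq_zero_or_pos k with rfl | hpos
    · rw [MvPolynomial.esymm_zero]; exact one_mem _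
    have key := MvPolynomial.mul_esymm_eq_sum (Fin n) K k
    have hmem : (k : MvPolynomial (Fin n) K) * MvPolynomial.esymm (Fin n) K k ∈
      (MvPolynomial.aeval (R := K) fun i : Fin n =>
        MvPolynomial.psum (Fin n) K (i + 1)).range := by
      rw [key]
      refine mul_mem (pow_mem (neg_mem (one_mem _)) _) (sum_mem fun a ha => ?_)
      rw [Finset.mem_filter, Finset.HasAntidiagonal.mem_antidiagonal] at ha
      refine mul_mem (mul_mem (pow_mem (neg_mem (one_mem _)) _) (ih _ ha.2 (by omega))) ?_
      refine ⟨MvPolynomial.X ⟨a.2 - 1, by omega⟩, ?_⟩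
      simp only [AlgHom.toRingHom_eq_coe, RingHom.coe_coe, MvPolynomial.aeval_X]
      congr 1
      omega
    have hk0 : (k : K) ≠ 0 := Nat.cast_ne_zero.mpr hpos.ne'
    have := Subalgebra.smul_mem _ hmem ((k : K)⁻¹)
    rwa [← nsmul_eq_mul, ← Nat.cast_smul_eq_nsmul K, smul_smul, inv_mul_cancel₀ hk0,
      one_smul] at this

/-- In `n` variables every symmetric polynomial is a polynomial in `p₁, …, pₙ`. -/
theorem exists_aeval_psum_eq (K : Type*) [Field K] [CharZero K] (n : ℕ)
    (g : MvPolynomial (Fin n) K) (hg : g.IsSymmetric) :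
    ∃ q : MvPolynomial (Fin n) K,
      MvPolynomial.aeval (fun i : Fin n => MvPolynomial.psum (Fin n) K (i + 1)) q = g := by
  obtain ⟨q, hq⟩ := (MvPolynomial.esymmAlgHom_fin_bijective K n).2 ⟨g, hg⟩
  have h1 := congrArg Subtype.val hq
  rw [MvPolynomial.esymmAlgHom_apply] at h1
  have h2 : (MvPolynomial.aeval fun i : Fin n => MvPolynomial.esymm (Fin n) K (i + 1)) q ∈
      (MvPolynomial.aeval (R := K) fun i : Fin n =>
        MvPolynomial.psum (Fin n) K (i + 1)).range := by
    rw [MvPolynomial.aeval_def, MvPolynomial.eval₂_eq]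
    refine sum_mem fun d _ => mul_mem (Subalgebra.algebraMap_mem _ _)
      (prod_mem fun i _ => pow_mem (esymm_mem_adjoin_psum K n _ (by omega)) _)
  rw [h1] at h2
  exact h2

/-- In `n` variables the power sums `p₁, …, pₙ` are algebraically independent. -/
theorem aeval_psum_injective (K : Type*) [Field K] [CharZero K] (n : ℕ) :
    Function.Injective (MvPolynomial.aeval (R := K) fun i : Fin n =>
        MvPolynomial.psum (Fin n) K (i + 1)) := by
  let P : MvPolynomial (Fin n) K →ₐ[K] MvPolynomial.symmetricSubalgebra (Fin n) K :=
    (MvPolynomial.aeval (R := K) fun i : Fin n => MvPolynomial.psum (Fin n) K (i + 1)).codRestrict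
      _ (fun q => by
        rw [MvPolynomial.aeval_def, MvPolynomial.eval₂_eq]
        exact sum_mem fun d _ => mul_mem (Subalgebra.algebraMap_mem _ _)
          (prod_mem fun i _ => pow_mem (MvPolynomial.psum_isSymmetric _ _ _) _))
  have hP : Function.Surjective P := fun g => by
    obtain ⟨q, hq⟩ := exists_aeval_psum_eq K n g.1 g.2
    exact ⟨q, Subtype.ext hq⟩
  let E := AlgEquiv.ofBijective _ (MvPolynomial.esymmAlgHom_fin_bijective K n)
  have hinj := injective_of_surjective_end ((E.symm.toAlgHom.comp P).toRingHom)
    (E.symm.surjective.comp hP)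
  intro a b hab
  refine hinj ?_
  have : P a = P b := Subtype.ext hab
  change E.symm (P a) = E.symm (P b)
  rw [this]

/-- The algebra homomorphism `K[y₀, y₁, …] → Λ`, `y_i ↦ p_{i+1}`. -/
def psumHom (K : Type*) [Field K] : MvPolynomial ℕ K →ₐ[K] SymFun K :=
  MvPolynomial.aeval fun i => psum K (i + 1)

theorem killCompl_psum (K : Type*) [Field K] (n r : ℕ) :
    killCompl (Fin.valEmbedding : Fin n ↪ ℕ) (psum K (r + 1) : MvPowerSeries ℕ K) =
      (MvPolynomial.psum (Fin n) K (r + 1) : MvPowerSeries (Fin n) K) := by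
  classical
  ext m
  rw [coeff_killCompl, MvPolynomial.coeff_coe, MvPolynomial.psum, MvPolynomial.coeff_sum]
  change (if _ then (1 : K) else 0) = _
  simp only [MvPolynomial.coeff_X_pow]
  split_ifs with h
  · obtain ⟨i, hi⟩ := h
    have hmem : i ∈ (Finsupp.embDomain Fin.valEmbedding m).support := by rw [hi]; simp
    rw [Finsupp.support_embDomain, Finset.mem_map] at hmem
    obtain ⟨j, _, rfl⟩ := hmem
    rw [← Finsupp.embDomain_single] at hi
    have := Finsupp.embDomain_injective _ hi
    subst this
    rw [Finset.sum_eq_single j, if_pos rfl]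
    · intro b _ hb
      exact if_neg fun h => hb ((Finsupp.single_left_inj (Nat.succ_ne_zero r)).mp h)
    · simp
  · rw [Finset.sum_eq_zero]
    intro i _
    refine if_neg ?_
    rintro rfl
    exact h ⟨i, by rw [Finsupp.embDomain_single]; rfl⟩

theorem killCompl_psumHom (K : Type*) [Field K] (n : ℕ) (q : MvPolynomial (Fin n) K) :
    killCompl (Fin.valEmbedding : Fin n ↪ ℕ)
      (psumHom K (MvPolynomial.rename Fin.val q) : MvPowerSeries ℕ K) =
      (MvPolynomial.aeval (fun i : Fin n => MvPolynomial.psum (Fin n) K (i + 1)) q :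
        MvPolynomial (Fin n) K) := by
  have : ((killCompl (Fin.valEmbedding : Fin n ↪ ℕ)).comp
      ((SymFun K).val.comp ((psumHom K).comp (MvPolynomial.rename Fin.val)))) =
      (MvPolynomial.coeToMvPowerSeries.algHom (R := K) K).comp
        (MvPolynomial.aeval (fun i : Fin n => MvPolynomial.psum (Fin n) K (i + 1))) := by
    refine MvPolynomial.algHom_ext fun i => ?_
    simp only [AlgHom.comp_apply, MvPolynomial.rename_X, psumHom, MvPolynomial.aeval_X,
      Subalgebra.coe_val, killCompl_psum]
    simp
  have := DFunLike.congr_fun this q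
  simpa using this

theorem psumHom_injective (K : Type*) [Field K] [CharZero K] :
    Function.Injective (psumHom K) := by
  rw [injective_iff_map_eq_zero]
  intro q hq
  obtain ⟨s, q', rfl⟩ := MvPolynomial.exists_finset_rename q
  obtain ⟨n, hn⟩ : ∃ n, ∀ i ∈ s, i < n := ⟨s.sup id + 1, fun i hi =>
    Nat.lt_succ_of_le (Finset.le_sup (f := id) hi)⟩
  let e : s → Fin n := fun i => ⟨i.1, hn _ i.2⟩
  have he : MvPolynomial.rename Subtype.val q' =
      MvPolynomial.rename Fin.val (MvPolynomial.rename e q') := by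
    rw [MvPolynomial.rename_rename]; rfl
  rw [he] at hq ⊢
  have h := killCompl_psumHom K n (MvPolynomial.rename e q')
  rw [hq] at h
  have h0 : (MvPolynomial.aeval (fun i : Fin n => MvPolynomial.psum (Fin n) K (i + 1))
      (MvPolynomial.rename e q')) = 0 := by
    refine MvPolynomial.coe_injective _ _ ?_
    rw [← h]; simp
  rw [(injective_iff_map_eq_zero _).mp (aeval_psum_injective K n) _ h0, map_zero]

/-- The part of degree at most `d` of a formal power series. -/
def truncDeg (K : Type*) [Field K] (d : ℕ) : MvPowerSeries ℕ K →ₗ[K] MvPowerSeries ℕ K where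
  toFun f := fun m => if m.degree ≤ d then coeff m f else 0
  map_add' f g := by
    ext m
    change (if m.degree ≤ d then coeff m (f + g) else 0) =
      (if m.degree ≤ d then coeff m f else 0) + (if m.degree ≤ d then coeff m g else 0)
    split_ifs <;> simp
  map_smul' r f := by
    ext m
    change (if m.degree ≤ d then coeff m (r • f) else 0) =
      r * (if m.degree ≤ d then coeff m f else 0)
    split_ifs <;> simp

theorem coeff_truncDeg (K : Type*) [Field K] (d : ℕ) (f : MvPowerSeries ℕ K) (m : ℕ →₀ ℕ) :
    coeff m (truncDeg K d f) = if m.degree ≤ d then coeff m f else 0 := rfl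

theorem psumHom_monomial_homogeneous (K : Type*) [Field K] (a : ℕ →₀ ℕ) (c : K) :
    ∃ w, ∀ m : ℕ →₀ ℕ, m.degree ≠ w →
      coeff m (psumHom K (MvPolynomial.monomial a c) : MvPowerSeries ℕ K) = 0 := by
  classical
  have hmul : ∀ f g : MvPowerSeries ℕ K, (∃ w, ∀ m : ℕ →₀ ℕ, m.degree ≠ w → coeff m f = 0) →
      (∃ w, ∀ m : ℕ →₀ ℕ, m.degree ≠ w → coeff m g = 0) →
      ∃ w, ∀ m : ℕ →₀ ℕ, m.degree ≠ w → coeff m (f * g) = 0 := by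
    rintro f g ⟨v, hv⟩ ⟨w, hw⟩
    refine ⟨v + w, fun m hm => ?_⟩
    rw [coeff_mul]
    refine Finset.sum_eq_zero fun p hp => ?_
    rw [Finset.HasAntidiagonal.mem_antidiagonal] at hp
    have : p.1.degree + p.2.degree = m.degree := by rw [← hp, map_add]
    by_cases h : p.1.degree = v
    · rw [hw _ (by omega), mul_zero]
    · rw [hv _ h, zero_mul]
  induction a using Finsupp.induction_linear generalizing c with
  | zero =>
    refine ⟨0, fun m hm => ?_⟩
    have h0 : m ≠ 0 := by rintro rfl; simp at hm
    have : (psumHom K (MvPolynomial.monomial 0 c) : MvPowerSeries ℕ K) = C c := by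
      change ((psumHom K (algebraMap K _ c) : SymFun K) : MvPowerSeries ℕ K) = _
      rw [AlgHom.commutes]; rfl
    rw [this, coeff_C, if_neg h0]
  | add a b ha hb =>
    have : MvPolynomial.monomial (a + b) c =
        MvPolynomial.monomial a c * MvPolynomial.monomial b (1 : K) := by
      rw [MvPolynomial.monomial_mul, mul_one]
    rw [this, map_mul]
    exact hmul _ _ (ha c) (hb 1)
  | single i n =>
    have hX : ∀ n, ∃ w, ∀ m : ℕ →₀ ℕ, m.degree ≠ w →
        coeff m ((psum K (i + 1) : MvPowerSeries ℕ K) ^ n) = 0 := by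
      intro n
      induction n with
      | zero =>
        refine ⟨0, fun m hm => ?_⟩
        have h0 : m ≠ 0 := by rintro rfl; simp at hm
        rw [pow_zero, coeff_one, if_neg h0]
      | succ n ih =>
        rw [pow_succ]
        refine hmul _ _ ih ⟨i + 1, fun m hm => ?_⟩
        change (if _ then (1 : K) else 0) = 0
        refine if_neg ?_
        rintro ⟨j, rfl⟩
        simp at hm
    obtain ⟨w, hw⟩ := hX n
    refine ⟨w, fun m hm => ?_⟩
    have : (psumHom K (MvPolynomial.monomial (Finsupp.single i n) c) : MvPowerSeries ℕ K) =
        c • (psum K (i + 1) : MvPowerSeries ℕ K) ^ n := by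
      rw [← MvPolynomial.C_mul_X_pow_eq_monomial, map_mul, map_pow, psumHom, MvPolynomial.aeval_X,
        MvPolynomial.algHom_C, ← Algebra.smul_def]
      rfl
    rw [this, coeff_smul, hw m hm, mul_zero]

theorem truncDeg_psumHom (K : Type*) [Field K] (d : ℕ) (q : MvPolynomial ℕ K) :
    ∃ q', (psumHom K q' : MvPowerSeries ℕ K) = truncDeg K d (psumHom K q : MvPowerSeries ℕ K) := by
  induction q using MvPolynomial.monomial_add_induction_on with
  | C c =>
    refine ⟨MvPolynomial.C c, ?_⟩
    classical
    ext m
    rw [coeff_truncDeg]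
    split_ifs with h
    · rfl
    · have h0 : m ≠ 0 := by rintro rfl; simp at h
      have : (psumHom K (MvPolynomial.C c) : MvPowerSeries ℕ K) = C c := by
        change ((psumHom K (algebraMap K _ c) : SymFun K) : MvPowerSeries ℕ K) = _
        rw [AlgHom.commutes]; rfl
      rw [this, coeff_C, if_neg h0]
  | monomial_add a b f _ _ hf =>
    obtain ⟨q1, h1⟩ := hf
    obtain ⟨w, hw⟩ := psumHom_monomial_homogeneous K a b
    by_cases hwd : w ≤ d
    · refine ⟨MvPolynomial.monomial a b + q1, ?_⟩
      simp only [map_add, Subalgebra.coe_add]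
      rw [h1]
      congr 1
      ext m
      rw [coeff_truncDeg]
      split_ifs with h
      · rfl
      · exact hw m (by omega)
    · refine ⟨q1, ?_⟩
      simp only [map_add, Subalgebra.coe_add]
      rw [h1, right_eq_add]
      ext m
      rw [coeff_truncDeg]
      split_ifs with h
      · exact hw m (by omega)
      · rfl

theorem psumHom_surjective (K : Type*) [Field K] [CharZero K] :
    Function.Surjective (psumHom K) := by
  classical
  rintro ⟨f, hf, d, hd⟩
  let e : Fin d ↪ ℕ := Fin.valEmbedding
  let g : MvPolynomial (Fin d) K :=
    ∑ m ∈ (Finset.univ : Finset (Fin d → Fin (d + 1))),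
      MvPolynomial.monomial (Finsupp.equivFunOnFinite.symm fun i => (m i : ℕ))
        (coeff (Finsupp.embDomain e (Finsupp.equivFunOnFinite.symm fun i => (m i : ℕ))) f)
  have hdeg : ∀ m : Fin d →₀ ℕ, (Finsupp.embDomain e m).degree = m.degree := fun m => by
    rw [Finsupp.embDomain_eq_mapDomain, Finsupp.degree_mapDomain]
  have hg : ∀ m, MvPolynomial.coeff m g = coeff (Finsupp.embDomain e m) f := by
    intro m
    simp only [g, MvPolynomial.coeff_sum, MvPolynomial.coeff_monomial]
    by_cases hm : ∀ i, m i < d + 1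
    · rw [Finset.sum_eq_single (fun i => ⟨m i, hm i⟩)]
      · have : (Finsupp.equivFunOnFinite.symm fun i => m i) = m := by ext; rfl
        simp [this]
      · intro b _ hb
        refine if_neg ?_
        rintro rfl
        exact hb rfl
      · simp
    · push Not at hm
      obtain ⟨i, hi⟩ := hm
      rw [Finset.sum_eq_zero, hd]
      · rw [hdeg]
        exact lt_of_lt_of_le (Nat.lt_of_succ_le hi) (Finsupp.le_degree i m)
      · intro b _
        refine if_neg ?_
        rintro rfl
        have := (b i).2
        simp only [Finsupp.equivFunOnFinite_symm_apply_apply] at hi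
        omega
  have hgsym : g.IsSymmetric := by
    intro σ
    ext m
    obtain ⟨m, rfl⟩ : ∃ m', m = Finsupp.mapDomain σ m' :=
      ⟨m.mapDomain σ.symm, by rw [← Finsupp.mapDomain_comp]; simp⟩
    rw [MvPolynomial.coeff_rename_mapDomain _ σ.injective, hg, hg,
      ← coeff_rename_perm (σ.extendDomain e.toEquivRange) f, hf]
    congr 2
    rw [Finsupp.embDomain_eq_mapDomain, Finsupp.embDomain_eq_mapDomain, ← Finsupp.mapDomain_comp,
      ← Finsupp.mapDomain_comp]
    congr 1
    ext i
    exact (Equiv.Perm.extendDomain_apply_image σ e.toEquivRange i)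
  obtain ⟨q, hq⟩ := exists_aeval_psum_eq K d g hgsym
  obtain ⟨q', hq'⟩ := truncDeg_psumHom K d (MvPolynomial.rename Fin.val q)
  refine ⟨q', Subtype.ext ?_⟩
  have hF := (psumHom K q').2.1
  generalize hFdef : (psumHom K q' : MvPowerSeries ℕ K) = F at hF hq'
  change F = f
  have hFg : ∀ m : Fin d →₀ ℕ, m.degree ≤ d → coeff (Finsupp.embDomain e m) F =
      coeff (Finsupp.embDomain e m) f := by
    intro m hm
    rw [hq', coeff_truncDeg, if_pos (by rwa [hdeg]), ← coeff_killCompl, killCompl_psumHom, hq,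
      MvPolynomial.coeff_coe, hg]
  ext m
  by_cases hm : m.degree ≤ d
  · have hcard : m.support.card ≤ d := le_trans (Finset.card_nsmul_le_sum _ (fun i => m i) 1
      (fun i hi => Nat.one_le_iff_ne_zero.mpr (Finsupp.mem_support_iff.mp hi)) |>.trans'
        (by simp)) hm
    let x : Fin m.support.card ↪ ℕ := (m.support.equivFin.symm.toEmbedding).trans
      (Function.Embedding.subtype _)
    let y : Fin m.support.card ↪ ℕ := Fin.valEmbedding
    obtain ⟨σ, hσ⟩ := (Equiv.Perm.isMultiplyPretransitive ℕ m.support.card).exists_smul_eq x y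
    have hσ' : ∀ i ∈ m.support, σ i < d := by
      intro i hi
      have := DFunLike.congr_fun hσ (m.support.equivFin ⟨i, hi⟩)
      have h2 : σ i = (m.support.equivFin ⟨i, hi⟩ : ℕ) := by
        simpa [x, y] using this
      rw [h2]
      exact lt_of_lt_of_le (Fin.is_lt _) hcard
    have hr : m.mapDomain σ ∈ Set.range (Finsupp.embDomain e) := by
      rw [Finsupp.mem_range_embDomain_iff]
      intro j hj
      rw [Finset.mem_coe, Finsupp.mapDomain_support_of_injective σ.injective, Finset.mem_image] at hj
      obtain ⟨i, hi, rfl⟩ := hj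
      exact ⟨⟨σ i, hσ' i hi⟩, rfl⟩
    obtain ⟨m', hm'⟩ := hr
    rw [← coeff_rename_perm σ F, ← coeff_rename_perm σ f, hF, hf, ← hm']
    refine hFg m' ?_
    rw [← hdeg, hm', Finsupp.degree_mapDomain]
    exact hm
  · rw [hd m (by omega), hq', coeff_truncDeg, if_neg hm]

/-- `Λ` is the polynomial ring in the power sums `p₁, p₂, …`. -/
def psumEquiv (K : Type*) [Field K] [CharZero K] : MvPolynomial ℕ K ≃ₐ[K] SymFun K :=
  AlgEquiv.ofBijective (psumHom K) ⟨psumHom_injective K, psumHom_surjective K⟩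

/-- The basis of `Λ` by products of power sums. The exponent vector `m : ℕ →₀ ℕ` stands for the
partition with `m i` parts equal to `i + 1`, and `psumBasis K m = ∏ i, p_{i+1} ^ (m i)`. -/
def psumBasis (K : Type*) [Field K] [CharZero K] : Module.Basis (ℕ →₀ ℕ) K (SymFun K) :=
  (MvPolynomial.basisMonomials ℕ K).map (psumEquiv K).toLinearEquiv

theorem psumBasis_apply (K : Type*) [Field K] [CharZero K] (m : ℕ →₀ ℕ) :
    psumBasis K m = m.prod fun i a => psum K (i + 1) ^ a := by
  change psumHom K (MvPolynomial.basisMonomials ℕ K m) = _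
  rw [MvPolynomial.coe_basisMonomials, psumHom, MvPolynomial.aeval_monomial, map_one, one_mul]

/-- `z_λ = 1^{m₁} m₁! 2^{m₂} m₂! ⋯`, with `m i` the number of parts equal to `i + 1`. -/
def zee (m : ℕ →₀ ℕ) : ℕ := m.prod fun i a => (i + 1) ^ a * a.factorial

/-- The Hall scalar product: the bilinear form on `Λ` with `⟨p_λ, p_μ⟩ = δ_{λμ} z_λ`. -/
def hall (K : Type*) [Field K] [CharZero K] : SymFun K →ₗ[K] SymFun K →ₗ[K] K :=
  (psumBasis K).constr K fun m => (zee m : K) • (psumBasis K).coord m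

theorem hall_psumBasis (K : Type*) [Field K] [CharZero K] (m n : ℕ →₀ ℕ) :
    hall K (psumBasis K m) (psumBasis K n) = if m = n then (zee m : K) else 0 := by
  classical
  rw [hall, Module.Basis.constr_basis, LinearMap.smul_apply, Module.Basis.coord_apply,
    Module.Basis.repr_self, Finsupp.single_apply]
  by_cases h : m = n
  · simp [h]
  · simp [h, Ne.symm h]

theorem psumBasis_add_single (K : Type*) [Field K] [CharZero K] (m : ℕ →₀ ℕ) (i : ℕ) :
    psumBasis K (m + Finsupp.single i 1) = psum K (i + 1) * psumBasis K m := by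
  rw [psumBasis_apply, psumBasis_apply, Finsupp.prod_add_index' (by simp) (fun _ _ _ => pow_add _ _ _),
    Finsupp.prod_single_index (by simp), pow_one, mul_comm]

theorem zee_add_single (m : ℕ →₀ ℕ) (i : ℕ) :
    zee (m + Finsupp.single i 1) = (i + 1) * (m i + 1) * zee m := by
  have key : ∀ m : ℕ →₀ ℕ, zee m =
      (i + 1) ^ m i * (m i).factorial * (m.erase i).prod fun j a => (j + 1) ^ a * a.factorial := by
    intro m
    rw [zee, ← Finsupp.mul_prod_erase' m i _ (by simp)]
  rw [key, key m]
  have : (m + Finsupp.single i 1).erase i = m.erase i := by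
    rw [Finsupp.erase_add, Finsupp.erase_single, add_zero]
  rw [this, Finsupp.add_apply, Finsupp.single_eq_same, pow_succ, Nat.factorial_succ]
  ring

/-- Every multiplication operator on `Λ` has an adjoint for the Hall scalar product. -/
theorem exists_perp {K : Type*} [Field K] [CharZero K] (f : SymFun K) :
    ∃ D : SymFun K →ₗ[K] SymFun K, ∀ g h, hall K (D g) h = hall K g (f * h) := by
  obtain ⟨q, rfl⟩ := psumHom_surjective K f
  induction q using MvPolynomial.induction_on with
  | C a =>
    refine ⟨a • LinearMap.id, fun g h => ?_⟩
    rw [MvPolynomial.algHom_C, ← Algebra.smul_def]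
    simp
  | add p q hp hq =>
    obtain ⟨D, hD⟩ := hp
    obtain ⟨E, hE⟩ := hq
    exact ⟨D + E, fun g h => by simp [hD, hE, add_mul]⟩
  | mul_X p i hp =>
    obtain ⟨D, hD⟩ := hp
    let P : SymFun K →ₗ[K] SymFun K := (psumBasis K).constr K fun m =>
      (((i + 1) * m i : ℕ) : K) • psumBasis K (m - Finsupp.single i 1)
    have hP : ∀ g h, hall K (P g) h = hall K g (psum K (i + 1) * h) := by
      have : (hall K).comp P =
          (hall K).compl₂ (LinearMap.mulLeft K (psum K (i + 1))) := by
        refine (psumBasis K).ext fun m => (psumBasis K).ext fun n => ?_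
        rw [LinearMap.comp_apply, LinearMap.compl₂_apply, LinearMap.mulLeft_apply,
          Module.Basis.constr_basis, ← psumBasis_add_single, map_smul, LinearMap.smul_apply,
          hall_psumBasis, hall_psumBasis]
        by_cases h0 : m i = 0
        · rw [h0]
          have : m ≠ n + Finsupp.single i 1 := by
            rintro rfl
            simp at h0
          simp [this]
        · obtain ⟨m, rfl⟩ : ∃ m', m = m' + Finsupp.single i 1 :=
            ⟨m - Finsupp.single i 1, by
              rw [tsub_add_cancel_of_le]
              rw [Finsupp.single_le_iff]
              omega⟩
          rw [add_tsub_cancel_right, zee_add_single]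
          by_cases h : m = n
          · subst h
            simp
          · simp [h]
      intro g h
      exact DFunLike.congr_fun (DFunLike.congr_fun this g) h
    refine ⟨P.comp D, fun g h => ?_⟩
    rw [LinearMap.comp_apply, hP, hD, map_mul (psumHom K), psumHom, MvPolynomial.aeval_X, mul_assoc]

theorem hall_left_injective {K : Type*} [Field K] [CharZero K] {f g : SymFun K}
    (h : ∀ u, hall K f u = hall K g u) : f = g := by
  refine (psumBasis K).repr.injective (Finsupp.ext fun m => ?_)
  have hz : (zee m : K) ≠ 0 := Nat.cast_ne_zero.mpr (Finset.prod_ne_zero_iff.mpr fun i _ =>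
    mul_ne_zero (pow_ne_zero _ (Nat.succ_ne_zero i)) (Nat.factorial_ne_zero _))
  have key : ∀ f : SymFun K, hall K f (psumBasis K m) = zee m * (psumBasis K).repr f m := by
    intro f
    have : (hall K).flip (psumBasis K m) = (zee m : K) • (psumBasis K).coord m := by
      classical
      refine (psumBasis K).ext fun n => ?_
      rw [LinearMap.flip_apply, hall_psumBasis, LinearMap.smul_apply, Module.Basis.coord_apply,
        Module.Basis.repr_self, Finsupp.single_apply]
      by_cases h : n = m <;> simp [h]
    exact DFunLike.congr_fun this f
  have := h (psumBasis K m)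
  rw [key, key] at this
  exact mul_left_cancel₀ hz this

/-- `f^⊥`, the operator on `Λ` adjoint to multiplication by `f`:
`⟨f^⊥ g, h⟩ = ⟨g, f h⟩` (see `hall_perp`, and `perp_unique` for the uniqueness). -/
def perp {K : Type*} [Field K] [CharZero K] (f : SymFun K) : SymFun K →ₗ[K] SymFun K :=
  (exists_perp f).choose

theorem hall_perp {K : Type*} [Field K] [CharZero K] (f g h : SymFun K) :
    hall K (perp f g) h = hall K g (f * h) := (exists_perp f).choose_spec g h

theorem perp_unique {K : Type*} [Field K] [CharZero K] (f g u : SymFun K)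
    (hu : ∀ h, hall K u h = hall K g (f * h)) : u = perp f g :=
  hall_left_injective fun h => by rw [hu, hall_perp]

section Operators

variable {K : Type*} [Field K] [CharZero K]

/-- The plethysm `f[X] ↦ f[X (t - 1)]`, the algebra endomorphism of `Λ` (over `K`) with
`p_i ↦ (t ^ i - 1) p_i`. -/
def plethysm (t : K) : SymFun K →ₐ[K] SymFun K :=
  (MvPolynomial.aeval fun i : ℕ => (t ^ (i + 1) - 1) • psum K (i + 1)).comp
    (psumEquiv K).symm.toAlgHom

/-- `h_r[X] = s_r[X]` for an arbitrary integer `r`, with `h_r = 0` for `r < 0`. -/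
def hsumInt (K : Type*) [Field K] (r : ℤ) : SymFun K :=
  if 0 ≤ r then hsum K r.toNat else 0

/-- The vertex operator `B_ℓ = ∑_{i ≥ 0} s_{i+ℓ}[X] (s_i[X (t - 1)])^⊥` for `ℓ ∈ ℤ`. Applied to
a given symmetric function, only finitely many terms are nonzero. -/
def vertexB (t : K) (l : ℤ) (f : SymFun K) : SymFun K :=
  ∑ᶠ i : ℕ, hsumInt K (i + l) * perp (plethysm t (hsum K i)) f

/-- `B_{α₁} B_{α₂} ⋯ B_{α_m} f` for a sequence of integers `α`. -/
def vertexBSeq (t : K) (α : List ℤ) (f : SymFun K) : SymFun K := α.foldr (vertexB t) f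

/-- The Hall-Littlewood function `H_λ[X;t] = B_{λ₁} ⋯ B_{λ_ℓ} · 1`. -/
def hallLittlewood (t : K) (l : List ℕ) : SymFun K := vertexBSeq t (l.map fun a => (a : ℤ)) 1

/-- The sequence of indices obtained from `λ` by applying the raising operators `e_{ij}`,
`(i,j) ∈ A`; each `e_{ij}` adds one to the `i`-th entry and subtracts one from the `j`-th. -/
def raise (l : List ℕ) (A : Finset (Fin l.length × Fin l.length)) : List ℤ :=
  List.ofFn fun r : Fin l.length =>
    (l.get r : ℤ) + (A.filter fun p => p.1 = r).card - (A.filter fun p => p.2 = r).card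

/-- `B_λ = ∏_{i<j} (1 - t e_{ij}) B_{λ₁} ⋯ B_{λ_m}` for a partition `λ` of length `m`, with the
product expanded over the sets `A` of pairs `i < j`. -/
def vertexBPart (t : K) (l : List ℕ) (f : SymFun K) : SymFun K :=
  ∑ A ∈ (Finset.univ.filter fun p : Fin l.length × Fin l.length => p.1 < p.2).powerset,
    (-t) ^ A.card • vertexBSeq t (raise l A) f

/-- The generalized Schur function product
`H_{(λ¹, λ², …)}[X;t] = B_{λ¹} H_{(λ², …)}[X;t]`, with `H_{()} = 1`. -/
def schurProduct (t : K) (S : List (List ℕ)) : SymFun K := S.foldr (vertexBPart t) 1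

/-- The `k`-split of a `k`-bounded partition `λ`: cut `λ` into consecutive blocks of main hook
length (first part plus number of parts minus one) equal to `k`, the last block having main hook
length at most `k`. A block with first part `a` thus has `k - a + 1` parts, unless it is the last
one, which may have fewer. -/
def kSplit (k : ℕ) : List ℕ → List (List ℕ)
  | [] => []
  | a :: l => (a :: l.take (k - a)) :: kSplit k (l.drop (k - a))
termination_by l => l.length
decreasing_by simp

/-- The `k`-split polynomial `G_λ^{(k)}[X;t]`. -/
def kSplitPoly (t : K) (k : ℕ) (l : List ℕ) : SymFun K := schurProduct t (kSplit k l)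

/-- The `k`-bounded partitions, as weakly decreasing lists of positive parts at most `k`. -/
def KBounded (k : ℕ) : Type :=
  {l : List ℕ // l.Pairwise (· ≥ ·) ∧ ∀ a ∈ l, 0 < a ∧ a ≤ k}

/-- The first part `λ₁` of a partition, `0` for the empty partition. -/
def firstPart (l : List ℕ) : ℕ := l.headD 0

/-- `λ < μ` in the dominance order on partitions of the same degree. -/
def DomLT (l m : List ℕ) : Prop :=
  l.sum = m.sum ∧ (∀ i, (l.take i).sum ≤ (m.take i).sum) ∧ l ≠ m

/-- `Λ_t^{(k)}`, the span of the `H_λ[X;t]` over `k`-bounded partitions `λ`. -/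
def LambdaK (t : K) (k : ℕ) : Submodule K (SymFun K) :=
  Submodule.span K (Set.range fun l : KBounded k => hallLittlewood t l.1)

open Classical in
/-- The projection `T̄_j^{(k)}` on `Λ_t^{(k)}`: `∑ c_μ G_μ^{(k)} ↦ ∑_{μ₁ = j} c_μ G_μ^{(k)}`.
It is well defined on `Λ_t^{(k)}` because the `G_μ^{(k)}` form a basis of it; functions
outside the span of the `G_μ^{(k)}` get the dummy value `0`. -/
def projT (t : K) (k j : ℕ) (f : SymFun K) : SymFun K :=
  if h : ∃ c : KBounded k →₀ K,
      f = Finsupp.linearCombination K (fun m : KBounded k => kSplitPoly t k m.1) c then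
    Finsupp.linearCombination K (fun m : KBounded k => kSplitPoly t k m.1)
      (h.choose.filter fun m => firstPart m.1 = j)
  else 0

/-- The `k`-Schur function: `s_λ^{(k)} = T̄_{λ₁}^{(k)} B_{λ₁} s_{(λ₂, λ₃, …)}^{(k)}`, with
`s_{()}^{(k)} = 1`. -/
def kSchur (t : K) (k : ℕ) : List ℕ → SymFun K
  | [] => 1
  | a :: l => projT t k a (vertexB t a (kSchur t k l))

end Operators

end KSchur

end

noncomputable section

namespace KSchur

open MvPowerSeries Finset.HasAntidiagonal

/-! ### Skewing operators: `p_r^⊥` as a derivation -/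

section Perp

variable {K : Type*} [Field K] [CharZero K]

/-! The families h_λ, H_λ, G_λ and s_λ are linked by unitriangular changes of basis for dominance
order. Integer words are compared by partial sums; each step expresses a new function as the old one
with the same index plus terms strictly higher in that order. Independence and spans then pass along
the chain, starting from the h_λ, which are independent because Λ is a polynomial ring in h₁, h₂, ….

Two facts about the vertex operators carry the argument. First, the i-th term of B_a moves i boxes
from the later entries of an h-word to a new first entry a, so B_α·1 is h_α plus strictly dominating
h-words (`vertexBSeq_sub_hsumWord_mem`); hence the H_λ are independent. Second, moving h_i[X(t-1)]^⊥
past multiplication by h_n produces the scalars h_j[t-1], whose generating function is (1-z)/(1-tz).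
Clearing the denominator gives the quadratic relation `vertexB_vertexB`, which rewrites an ascent
B_m B_n, m < n, by pairs whose first index is larger and whose indices do not exceed n. Hence B_α·1
with entries at most k is a ℤ[t]-combination of H_μ with μ k-bounded and μ dominating α
(`vertexBSeq_mem_span`). Stability under B_j for j ≤ k is the case α = (j, λ).

In a block of main hook length at most k, the raising operators add to an entry at most the number
of parts minus one, so all indices stay at most k (`raise_le`). Straightening then gives G_λ = H_λ +
higher terms, over ℤ[t].

For the k-Schur functions, induct on the number of parts: if s_l is H_l plus higher terms, then B_a
s_l is H_{(a,l)} plus higher terms, hence G_{(a,l)} plus higher terms. The projection fixes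
G_{(a,l)} and keeps only the higher terms with first part a (`kSchur_sub_kSplitPoly_mem`). -/

theorem perp_perp (f g u : SymFun K) : perp f (perp g u) = perp (f * g) u :=
  perp_unique _ _ _ fun h => by rw [hall_perp, hall_perp, mul_left_comm, mul_assoc]

theorem perp_comm (f g u : SymFun K) : perp f (perp g u) = perp g (perp f u) := by
  rw [perp_perp, perp_perp, mul_comm]

theorem perp_one : perp (1 : SymFun K) = LinearMap.id :=
  LinearMap.ext fun u => (perp_unique _ _ _ fun h => by simp).symm

/-- `perp` as a linear map in both arguments. -/
def perpLin (K : Type*) [Field K] [CharZero K] :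
    SymFun K →ₗ[K] SymFun K →ₗ[K] SymFun K where
  toFun := perp
  map_add' f g := LinearMap.ext fun u => (perp_unique _ _ _ fun h => by
    simp [hall_perp, add_mul]).symm
  map_smul' c f := LinearMap.ext fun u => (perp_unique _ _ _ fun h => by
    simp [hall_perp]).symm

theorem perpLin_apply (f : SymFun K) : perpLin K f = perp f := rfl

/-- The skewing operator `p_{i+1}^⊥` is `(i + 1) ∂ / ∂p_{i+1}`. -/
theorem perp_psum (i : ℕ) (f : SymFun K) :
    perp (psum K (i + 1)) f = ((i + 1 : ℕ) : K) •
      psumEquiv K (MvPolynomial.pderiv i ((psumEquiv K).symm f)) := by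
  let P : SymFun K →ₗ[K] SymFun K := ((i + 1 : ℕ) : K) •
    ((psumEquiv K).toLinearMap ∘ₗ (MvPolynomial.pderiv i).toLinearMap ∘ₗ
      (psumEquiv K).symm.toLinearMap)
  have hPb : ∀ m : ℕ →₀ ℕ, P (psumBasis K m) =
      (((i + 1) * m i : ℕ) : K) • psumBasis K (m - Finsupp.single i 1) := by
    intro m
    have h1 : ∀ m, psumBasis K m = psumEquiv K (MvPolynomial.monomial m 1) := fun m => by
      simp [psumBasis]
    have h2 : ∀ c : K, MvPolynomial.monomial (m - Finsupp.single i 1) c =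
        c • MvPolynomial.monomial (m - Finsupp.single i 1) (1 : K) := fun c => by
      rw [MvPolynomial.smul_monomial, smul_eq_mul, mul_one]
    rw [h1, h1]
    change ((i + 1 : ℕ) : K) • psumEquiv K (MvPolynomial.pderiv i ((psumEquiv K).symm
      (psumEquiv K (MvPolynomial.monomial m 1)))) = _
    rw [AlgEquiv.symm_apply_apply, MvPolynomial.pderiv_monomial, h2, map_smul, smul_smul]
    push_cast
    congr 1
    ring
  have hP : ∀ g h, hall K (P g) h = hall K g (psum K (i + 1) * h) := by
    have : (hall K).comp P = (hall K).compl₂ (LinearMap.mulLeft K (psum K (i + 1))) := by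
      refine (psumBasis K).ext fun m => (psumBasis K).ext fun n => ?_
      rw [LinearMap.comp_apply, LinearMap.compl₂_apply, LinearMap.mulLeft_apply, hPb,
        ← psumBasis_add_single, map_smul, LinearMap.smul_apply, hall_psumBasis, hall_psumBasis]
      by_cases h0 : m i = 0
      · have : m ≠ n + Finsupp.single i 1 := by
          rintro rfl
          simp at h0
        simp [this, h0]
      · obtain ⟨m, rfl⟩ : ∃ m', m = m' + Finsupp.single i 1 :=
          ⟨m - Finsupp.single i 1, by
            rw [tsub_add_cancel_of_le]
            rw [Finsupp.single_le_iff]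
            omega⟩
        rw [add_tsub_cancel_right, zee_add_single]
        by_cases h : m = n
        · subst h
          simp
        · simp [h]
    intro g h
    exact DFunLike.congr_fun (DFunLike.congr_fun this g) h
  exact (perp_unique _ _ _ (hP f)).symm

/-- Leibniz rule for a multiple of ∂/∂p_{i+1}. Later formulas for skewing operators come from
pushing this rule through Newton's identity. -/
theorem perp_psum_mul (i : ℕ) (f g : SymFun K) :
    perp (psum K (i + 1)) (f * g) =
      perp (psum K (i + 1)) f * g + f * perp (psum K (i + 1)) g := by
  simp only [perp_psum, map_mul, Derivation.leibniz, map_add, smul_eq_mul,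
    AlgEquiv.apply_symm_apply, smul_add, smul_mul_assoc, mul_smul_comm]
  rw [mul_comm g, add_comm]

theorem perp_psum_one (i : ℕ) : perp (psum K (i + 1)) (1 : SymFun K) = 0 := by
  have := perp_psum_mul i (1 : SymFun K) 1
  simpa using this

theorem psumEquiv_X (i : ℕ) : psumEquiv K (MvPolynomial.X i) = psum K (i + 1) :=
  MvPolynomial.aeval_X _ _

theorem perp_psum_psum (i j : ℕ) :
    perp (psum K (i + 1)) (psum K (j + 1)) = if i = j then ((i + 1 : ℕ) : SymFun K) else 0 := by
  rw [perp_psum, ← psumEquiv_X, AlgEquiv.symm_apply_apply, MvPolynomial.pderiv_X]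
  by_cases h : i = j
  · subst h
    simp [Algebra.smul_def]
  · simp [h, Ne.symm h]

end Perp

/-! ### Newton's identity between power sums and complete functions -/

section Newton

variable {K : Type*} [Field K]

theorem coeff_hsum (n : ℕ) (m : ℕ →₀ ℕ) :
    coeff m (hsum K n : MvPowerSeries ℕ K) = if m.degree = n then 1 else 0 := rfl

/-- To factor x^m as x_i^{r+1} times a monomial is to choose a variable whose exponent in m exceeds
r. -/
theorem coeff_psum_mul_hsum (r n : ℕ) (m : ℕ →₀ ℕ) :
    coeff m ((psum K (r + 1) * hsum K n : SymFun K) : MvPowerSeries ℕ K) =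
      if m.degree = r + 1 + n then ((m.support.filter fun i => r < m i).card : K) else 0 := by
  classical
  have hp : ∀ a, coeff a (psum K (r + 1) : MvPowerSeries ℕ K) =
      if ∃ i, a = Finsupp.single i (r + 1) then 1 else 0 := fun a => by
    change (if _ then (1 : K) else 0) = _
    congr
  have key : ∀ i, r < m i → (Finsupp.single i (r + 1) + (m - Finsupp.single i (r + 1)) = m) :=
    fun i hi => by
      rw [add_tsub_cancel_of_le]
      rwa [Finsupp.single_le_iff]
  rw [MulMemClass.coe_mul, coeff_mul]
  simp only [hp, coeff_hsum, ite_mul, one_mul, zero_mul]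
  rw [← Finset.sum_filter, Finset.sum_congr (g := fun _ => if m.degree = r + 1 + n then (1 : K)
    else 0) rfl, Finset.sum_const]
  · have hc : ((antidiagonal m).filter
        fun p => ∃ i, p.1 = Finsupp.single i (r + 1)).card =
        (m.support.filter fun i => r < m i).card := by
      symm
      refine Finset.card_bij
        (fun i _ => (Finsupp.single i (r + 1), m - Finsupp.single i (r + 1))) ?_ ?_ ?_
      · intro i hi
        rw [Finset.mem_filter] at hi
        rw [Finset.mem_filter, mem_antidiagonal]
        exact ⟨key i hi.2, i, rfl⟩
      · intro i _ j _ h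
        exact (Finsupp.single_left_inj (Nat.succ_ne_zero r)).mp (Prod.ext_iff.mp h).1
      · rintro ⟨a, b⟩ h
        rw [Finset.mem_filter, mem_antidiagonal] at h
        obtain ⟨rfl, i, rfl⟩ := h
        refine ⟨i, ?_, ?_⟩
        · simp; omega
        · simp
    rw [hc]
    split_ifs <;> simp
  · rintro ⟨a, b⟩ h
    rw [Finset.mem_filter, mem_antidiagonal] at h
    obtain ⟨rfl, i, rfl⟩ := h
    simp

/-- Newton's identity `n h_n = ∑ p_r h_{n-r}`. -/
theorem newton_hsum (n : ℕ) : ((n + 1 : ℕ) : K) • hsum K (n + 1) =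
    ∑ p ∈ antidiagonal n, psum K (p.1 + 1) * hsum K p.2 := by
  refine Subtype.ext (MvPowerSeries.ext fun m => ?_)
  rw [AddSubmonoidClass.coe_finsetSum, map_sum]
  simp only [coeff_psum_mul_hsum]
  change _ * coeff m (hsum K (n + 1) : MvPowerSeries ℕ K) = _
  rw [coeff_hsum]
  by_cases h : m.degree = n + 1
  · rw [if_pos h, mul_one, Finset.sum_congr (g := fun p : ℕ × ℕ =>
      ((m.support.filter fun i => p.1 < m i).card : K)) rfl]
    · rw [Finset.Nat.sum_antidiagonal_eq_sum_range_succ_mk]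
      simp only [Finset.card_filter]
      push_cast
      -- Counting the pairs (r, i) with r < m i by i gives the sum of the exponents, the degree n +
      -- 1.
      rw [Finset.sum_comm, Finset.sum_congr (g := fun i => (m i : K)) rfl]
      · rw [← Nat.cast_sum]
        have : (∑ i ∈ m.support, m i) = m.degree := rfl
        rw [this, h]; push_cast; ring
      · intro i hi
        have hle : m i ≤ n + 1 := h ▸ Finsupp.le_degree i m
        rw [← Finset.sum_filter, Finset.sum_const]
        have : (Finset.range n.succ).filter (fun r => r < m i) = Finset.range (m i) := by
          ext r; simp; omega
        rw [this]; simp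
    · rintro ⟨a, b⟩ hab
      rw [mem_antidiagonal] at hab
      rw [if_pos]; rw [h]; simp at hab; omega
  · rw [if_neg h, mul_zero, Finset.sum_eq_zero]
    rintro ⟨a, b⟩ hab
    rw [mem_antidiagonal] at hab
    rw [if_neg]; simp at hab ⊢; omega

theorem hsum_zero : hsum K 0 = 1 := by
  classical
  refine Subtype.ext (MvPowerSeries.ext fun m => ?_)
  rw [coeff_hsum]
  simp only [Finsupp.degree_eq_zero_iff]
  exact (coeff_one m).symm

/-- In Newton's identity p_{k+1} has coefficient h_0 = 1, so it can be solved for in terms of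
smaller power sums and the h_j. -/
theorem psum_mem_adjoin_hsum (n k : ℕ) (hk : k < n) :
    psum K (k + 1) ∈ (MvPolynomial.aeval (R := K) fun i : Fin n => hsum K (i + 1)).range := by
  have hh : ∀ j, j ≤ n →
      hsum K j ∈ (MvPolynomial.aeval (R := K) fun i : Fin n => hsum K (i + 1)).range := by
    rintro (_ | j) hj
    · rw [hsum_zero]; exact one_mem _
    · exact ⟨MvPolynomial.X ⟨j, hj⟩, by simp⟩
  induction k using Nat.strong_induction_on with
  | _ k ih =>
    have h := newton_hsum (K := K) k
    have hmem : ((k, 0) : ℕ × ℕ) ∈ antidiagonal k := by rw [mem_antidiagonal]; simp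
    rw [← Finset.add_sum_erase _ _ hmem, hsum_zero, mul_one] at h
    rw [← sub_eq_iff_eq_add] at h
    rw [← h]
    refine sub_mem (Subalgebra.smul_mem _ (hh _ (by omega)) _) (sum_mem fun p hp => ?_)
    rw [Finset.mem_erase, mem_antidiagonal] at hp
    have : p.1 ≠ k := fun h => hp.1 (Prod.ext h (by simp; omega))
    exact mul_mem (ih _ (by omega) (by omega)) (hh _ (by omega))

theorem hsumInt_natCast (n : ℕ) : hsumInt K n = hsum K n := by simp [hsumInt]

theorem hsumInt_of_neg {n : ℤ} (h : n < 0) : hsumInt K n = 0 := by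
  rw [hsumInt, if_neg (by omega)]

end Newton

/-! ### Skewing of `h_n` by power sums; the `h_n` as free generators of `Λ` -/

section Generators

variable {K : Type*} [Field K] [CharZero K]

/-- Apply the derivation to Newton's identity for (n+1) h_{n+1}. Terms where it hits a power sum
give r+1 copies of h_{n-r}; terms where it hits some h_b form, by induction, Newton's identity in
degree n-r and give n-r copies. -/
theorem perp_psum_hsum (r n : ℕ) :
    perp (psum K (r + 1)) (hsum K n) = hsumInt K ((n : ℤ) - (r + 1)) := by
  induction n using Nat.strong_induction_on with
  | _ n ih =>
    rcases n with _ | n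
    · rw [hsum_zero, perp_psum_one, hsumInt_of_neg (by omega)]
    have h0 : ((n + 1 : ℕ) : K) ≠ 0 := Nat.cast_ne_zero.mpr (Nat.succ_ne_zero n)
    refine smul_right_injective _ h0 ?_
    change ((n + 1 : ℕ) : K) • _ = ((n + 1 : ℕ) : K) • _
    rw [← map_smul, newton_hsum, map_sum]
    simp only [perp_psum_mul, perp_psum_psum, Finset.sum_add_distrib]
    have e1 : ∑ p ∈ antidiagonal n, (if r = p.1 then ((r + 1 : ℕ) : SymFun K) else 0) * hsum K p.2 =
        ((r + 1 : ℕ) : K) • hsumInt K (((n + 1 : ℕ) : ℤ) - (r + 1)) := by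
      by_cases hr : r ≤ n
      · rw [Finset.sum_eq_single (r, n - r)]
        · have : ((n + 1 : ℕ) : ℤ) - (r + 1) = ((n - r : ℕ) : ℤ) := by omega
          rw [if_pos rfl, this, hsumInt_natCast, Nat.cast_smul_eq_nsmul, nsmul_eq_mul]
        · rintro ⟨a, b⟩ hab hne
          rw [mem_antidiagonal] at hab
          rw [if_neg, zero_mul]
          rintro rfl
          refine hne (Prod.ext rfl ?_)
          simp at hab ⊢; omega
        · intro h
          rw [mem_antidiagonal] at h
          simp at h; omega
      · rw [hsumInt_of_neg (by omega), smul_zero, Finset.sum_eq_zero]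
        rintro ⟨a, b⟩ hab
        rw [mem_antidiagonal] at hab
        rw [if_neg, zero_mul]
        rintro rfl
        simp at hab; omega
    have e2 : ∑ p ∈ antidiagonal n, psum K (p.1 + 1) * perp (psum K (r + 1)) (hsum K p.2) =
        ((n : K) - r) • hsumInt K (((n + 1 : ℕ) : ℤ) - (r + 1)) := by
      rw [Finset.sum_congr (g := fun p : ℕ × ℕ => psum K (p.1 + 1) *
        hsumInt K ((p.2 : ℤ) - (r + 1))) rfl]
      swap
      · rintro ⟨a, b⟩ hab
        rw [mem_antidiagonal] at hab
        rw [ih b (by simp at hab; omega)]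
      by_cases hr : r + 1 ≤ n
      · obtain ⟨m, rfl⟩ := Nat.exists_eq_add_of_le hr
        have h3 : (((r + 1 + m + 1 : ℕ) : ℤ) - (r + 1)) = ((m + 1 : ℕ) : ℤ) := by
          push_cast; ring
        have h4 : (((r + 1 + m : ℕ) : K) - r) = ((m + 1 : ℕ) : K) := by push_cast; ring
        rw [h3, h4, hsumInt_natCast, newton_hsum]
        symm
        refine Finset.sum_of_injOn (fun p => (p.1, p.2 + (r + 1))) ?_ ?_ ?_ ?_
        · rintro ⟨a, b⟩ _ ⟨c, d⟩ _ h
          simpa using h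
        · rintro ⟨a, b⟩ hab
          simp only [Finset.mem_coe, mem_antidiagonal] at hab ⊢
          omega
        · rintro ⟨a, b⟩ hab hn
          rw [mem_antidiagonal] at hab
          rw [hsumInt_of_neg, mul_zero]
          by_contra hb
          refine hn ⟨(a, b - (r + 1)), ?_, ?_⟩
          · simp only [Finset.mem_coe, mem_antidiagonal] at hab ⊢
            push Not at hb
            simp only at hb
            omega
          · simp only [Prod.mk.injEq, true_and] at hb ⊢
            omega
        · rintro ⟨a, b⟩ _
          simp only
          rw [← hsumInt_natCast (K := K) b]
          congr 2
          push_cast; ring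
      · rw [Finset.sum_eq_zero]
        · by_cases h : r = n
          · subst h; simp
          · rw [hsumInt_of_neg (by omega), smul_zero]
        · rintro ⟨a, b⟩ hab
          rw [mem_antidiagonal] at hab
          rw [hsumInt_of_neg, mul_zero]
          simp only at hab ⊢
          omega
    rw [e1, e2, ← add_smul]
    congr 1
    push_cast; ring

theorem perp_psum_hsumInt (r : ℕ) (n : ℤ) :
    perp (psum K (r + 1)) (hsumInt K n) = hsumInt K (n - (r + 1)) := by
  rcases lt_or_ge n 0 with h | h
  · rw [hsumInt_of_neg h, hsumInt_of_neg (by omega), map_zero]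
  · obtain ⟨n, rfl⟩ := Int.eq_ofNat_of_zero_le h
    rw [hsumInt_natCast, perp_psum_hsum]

/-- The algebra homomorphism `K[y₀, y₁, …] → Λ`, `y_i ↦ h_{i+1}`. -/
def hsumHom (K : Type*) [Field K] : MvPolynomial ℕ K →ₐ[K] SymFun K :=
  MvPolynomial.aeval fun i => hsum K (i + 1)

theorem hsum_mem_adjoin_psum (n k : ℕ) (hk : k ≤ n) :
    hsum K k ∈ (MvPolynomial.aeval (R := K) fun i : Fin n => psum K (i + 1)).range := by
  induction k using Nat.strong_induction_on with
  | _ k ih =>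
    rcases k with _ | k
    · rw [hsum_zero]; exact one_mem _
    have h0 : ((k + 1 : ℕ) : K) ≠ 0 := Nat.cast_ne_zero.mpr (Nat.succ_ne_zero k)
    have := Subalgebra.smul_mem (MvPolynomial.aeval (R := K) fun i : Fin n => psum K (i + 1)).range
      (x := ((k + 1 : ℕ) : K) • hsum K (k + 1)) ?_ ((k + 1 : ℕ) : K)⁻¹
    · rwa [smul_smul, inv_mul_cancel₀ h0, one_smul] at this
    · rw [newton_hsum]
      refine sum_mem fun p hp => ?_
      rw [mem_antidiagonal] at hp
      exact mul_mem ⟨MvPolynomial.X ⟨p.1, by omega⟩, by simp⟩ (ih _ (by omega) (by omega))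

theorem hsumHom_surjective : Function.Surjective (hsumHom K) := by
  rw [← AlgHom.range_eq_top, eq_top_iff, ← (AlgHom.range_eq_top _).mpr (psumHom_surjective K)]
  rintro _ ⟨q, rfl⟩
  change psumHom K q ∈ _
  rw [psumHom, MvPolynomial.aeval_def, MvPolynomial.eval₂_eq]
  refine sum_mem fun d _ => mul_mem (Subalgebra.algebraMap_mem _ _)
    (prod_mem fun i _ => pow_mem ?_ _)
  obtain ⟨q, hq⟩ := psum_mem_adjoin_hsum (K := K) (i + 1) i (by omega)
  refine ⟨MvPolynomial.rename Fin.val q, ?_⟩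
  rw [← hq, hsumHom]
  change MvPolynomial.aeval _ (MvPolynomial.rename Fin.val q) = _
  rw [MvPolynomial.aeval_rename]
  rfl

/-- The substitution of the h_i is that of the independent p_i precomposed with an endomorphism φ of
K[y₁, …, y_n]. Since the p_i are polynomials in the h_i, φ is surjective, hence injective because
the ring is Noetherian. -/
theorem aeval_hsum_injective (n : ℕ) :
    Function.Injective (MvPolynomial.aeval (R := K) fun i : Fin n => hsum K (i + 1)) := by
  have hA : Function.Injective (MvPolynomial.aeval (R := K) fun i : Fin n => psum K (i + 1)) := by
    have : (MvPolynomial.aeval (R := K) fun i : Fin n => psum K (i + 1)) =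
        (psumHom K).comp (MvPolynomial.rename Fin.val) := by
      refine MvPolynomial.algHom_ext fun i => ?_
      simp [psumHom]
    rw [this]
    exact (psumHom_injective K).comp (MvPolynomial.rename_injective _ Fin.val_injective)
  have hex : ∀ i : Fin n, ∃ q, MvPolynomial.aeval (R := K) (fun i : Fin n => psum K (i + 1)) q =
      hsum K (i + 1) := fun i => hsum_mem_adjoin_psum n (i + 1) (by omega)
  choose q hq using hex
  let φ : MvPolynomial (Fin n) K →ₐ[K] MvPolynomial (Fin n) K := MvPolynomial.aeval q
  have hφ : (MvPolynomial.aeval (R := K) fun i : Fin n => hsum K (i + 1)) =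
      (MvPolynomial.aeval (R := K) fun i : Fin n => psum K (i + 1)).comp φ := by
    refine MvPolynomial.algHom_ext fun i => ?_
    simp [φ, hq]
  have hs : Function.Surjective φ := by
    rw [← AlgHom.range_eq_top, eq_top_iff, ← MvPolynomial.adjoin_range_X, Algebra.adjoin_le_iff]
    rintro _ ⟨i, rfl⟩
    obtain ⟨r, hr⟩ := psum_mem_adjoin_hsum (K := K) n i i.2
    refine ⟨r, hA ?_⟩
    rw [MvPolynomial.aeval_X, ← hr]
    exact (DFunLike.congr_fun hφ r).symm
  rw [hφ]
  exact hA.comp (injective_of_surjective_end φ.toRingHom hs)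

theorem hsumHom_injective : Function.Injective (hsumHom K) := by
  rw [injective_iff_map_eq_zero]
  intro q hq
  obtain ⟨s, q', rfl⟩ := MvPolynomial.exists_finset_rename q
  obtain ⟨n, hn⟩ : ∃ n, ∀ i ∈ s, i < n := ⟨s.sup id + 1, fun i hi =>
    Nat.lt_succ_of_le (Finset.le_sup (f := id) hi)⟩
  let e : s → Fin n := fun i => ⟨i.1, hn _ i.2⟩
  have he : MvPolynomial.rename Subtype.val q' =
      MvPolynomial.rename Fin.val (MvPolynomial.rename e q') := by
    rw [MvPolynomial.rename_rename]; rfl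
  rw [he] at hq ⊢
  rw [hsumHom, MvPolynomial.aeval_rename] at hq
  rw [(injective_iff_map_eq_zero _).mp (aeval_hsum_injective (K := K) n) _ hq, map_zero]

end Generators

/-! ### Reindexing sums over triples with fixed total -/

section Triple

variable {M : Type*} [AddCommMonoid M]

theorem sum_antidiagonal_assoc (n : ℕ) (f : ℕ → ℕ → ℕ → M) :
    ∑ p ∈ antidiagonal n, ∑ q ∈ antidiagonal p.2, f p.1 q.1 q.2 =
      ∑ p ∈ antidiagonal n, ∑ q ∈ antidiagonal p.1, f q.1 q.2 p.2 := by
  rw [Finset.sum_sigma', Finset.sum_sigma']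
  refine Finset.sum_nbij' (fun x => ⟨(x.1.1 + x.2.1, x.2.2), (x.1.1, x.2.1)⟩)
    (fun x => ⟨(x.2.1, x.2.2 + x.1.2), (x.2.2, x.1.2)⟩) ?_ ?_ ?_ ?_ ?_
  · rintro ⟨⟨a, b⟩, ⟨c, d⟩⟩ h
    simp only [Finset.mem_sigma, mem_antidiagonal] at h ⊢
    obtain ⟨rfl, rfl⟩ := h
    exact ⟨add_assoc _ _ _, trivial⟩
  · rintro ⟨⟨a, b⟩, ⟨c, d⟩⟩ h
    simp only [Finset.mem_sigma, mem_antidiagonal] at h ⊢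
    obtain ⟨rfl, rfl⟩ := h
    exact ⟨(add_assoc _ _ _).symm, trivial⟩
  · rintro ⟨⟨a, b⟩, ⟨c, d⟩⟩ h
    simp only [Finset.mem_sigma, mem_antidiagonal] at h ⊢
    obtain ⟨rfl, rfl⟩ := h
    rfl
  · rintro ⟨⟨a, b⟩, ⟨c, d⟩⟩ h
    simp only [Finset.mem_sigma, mem_antidiagonal] at h ⊢
    obtain ⟨rfl, rfl⟩ := h
    rfl
  · rintro ⟨⟨a, b⟩, ⟨c, d⟩⟩ h
    rfl

theorem sum_antidiagonal_left_comm (n : ℕ) (f : ℕ → ℕ → ℕ → M) :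
    ∑ p ∈ antidiagonal n, ∑ q ∈ antidiagonal p.2, f p.1 q.1 q.2 =
      ∑ p ∈ antidiagonal n, ∑ q ∈ antidiagonal p.2, f q.1 p.1 q.2 := by
  rw [sum_antidiagonal_assoc, sum_antidiagonal_assoc n fun a b c => f b a c]
  exact Finset.sum_congr rfl fun p _ =>
    (Finset.Nat.sum_antidiagonal_swap (f := fun q : ℕ × ℕ => f q.1 q.2 p.2)).symm

end Triple

/-! ### The scalars `h_n[t - 1]` -/

section Scalar

variable {K : Type*} [Field K]

/-- The scalar `h_n[t - 1]`. -/
def hsumScalar (t : K) : ℕ → K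
  | 0 => 1
  | n + 1 => t ^ (n + 1) - t ^ n

/-- Newton's identity evaluated at the alphabet t - 1, where p_r becomes t^r - 1 and the h_n have
generating function (1-z)/(1-tz). The sum telescopes. -/
theorem newton_hsumScalar (t : K) (n : ℕ) : ((n + 1 : ℕ) : K) * hsumScalar t (n + 1) =
    ∑ p ∈ antidiagonal n, (t ^ (p.1 + 1) - 1) * hsumScalar t p.2 := by
  have key : ∀ n : ℕ, ∑ p ∈ antidiagonal n, (t ^ (p.1 + 1) - 1) * hsumScalar t p.2 =
      ((n + 1 : ℕ) : K) * (t ^ (n + 1) - t ^ n) := by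
    intro n
    rw [← Finset.Nat.sum_antidiagonal_swap]
    simp only [Prod.fst_swap, Prod.snd_swap]
    rcases n with _ | n
    · simp [hsumScalar]
    rw [Finset.Nat.sum_antidiagonal_succ]
    have : ∀ p ∈ antidiagonal n, (t ^ (p.2 + 1) - 1) * hsumScalar t (p.1 + 1) =
        (t ^ (n + 2) - t ^ (n + 1)) - (t ^ (p.1 + 1) - t ^ p.1) := by
      rintro ⟨a, b⟩ h
      rw [mem_antidiagonal] at h
      simp only [hsumScalar] at h ⊢
      rw [← h]; ring
    rw [Finset.sum_congr rfl this, Finset.sum_sub_distrib, Finset.sum_const,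
      Finset.Nat.card_antidiagonal,
      Finset.Nat.sum_antidiagonal_eq_sum_range_succ (fun a _ => t ^ (a + 1) - t ^ a),
      Finset.sum_range_sub]
    simp only [hsumScalar, nsmul_eq_mul, Nat.succ_eq_add_one]
    push_cast
    ring
  exact (key n).symm

end Scalar

/-! ### Skewing by `h_n[X(t - 1)]` and the commutation relation of vertex operators -/

section Skew

variable {K : Type*} [Field K] [CharZero K]

/-- The skewing operator `(h_n[X (t - 1)])^⊥`. -/
def skewH (t : K) (n : ℕ) : SymFun K →ₗ[K] SymFun K := perp (plethysm t (hsum K n))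

theorem plethysm_psum (t : K) (i : ℕ) :
    plethysm t (psum K (i + 1)) = (t ^ (i + 1) - 1) • psum K (i + 1) := by
  have h : (psumEquiv K).symm (psum K (i + 1)) = MvPolynomial.X i := by
    rw [← psumEquiv_X, AlgEquiv.symm_apply_apply]
  change MvPolynomial.aeval _ ((psumEquiv K).symm (psum K (i + 1))) = _
  rw [h, MvPolynomial.aeval_X]

theorem skewH_zero (t : K) : skewH t 0 = LinearMap.id := by
  rw [skewH, hsum_zero, map_one, perp_one]

theorem perp_psum_skewH (t : K) (r n : ℕ) (f : SymFun K) :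
    perp (psum K (r + 1)) (skewH t n f) = skewH t n (perp (psum K (r + 1)) f) := perp_comm _ _ _

theorem skewH_comm (t : K) (i j : ℕ) (f : SymFun K) :
    skewH t i (skewH t j f) = skewH t j (skewH t i f) := perp_comm _ _ _

/-- Newton's identity carried through the plethysm and `perp`. Dividing by n + 1 makes it a
recursion for `skewH`. -/
theorem newton_skewH (t : K) (n : ℕ) (f : SymFun K) : ((n + 1 : ℕ) : K) • skewH t (n + 1) f =
    ∑ p ∈ antidiagonal n, (t ^ (p.1 + 1) - 1) • perp (psum K (p.1 + 1)) (skewH t p.2 f) := by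
  have h := congrArg (fun u => perpLin K (plethysm t u) f) (newton_hsum (K := K) n)
  simpa only [skewH, map_smul, map_sum, map_mul, LinearMap.smul_apply, LinearMap.sum_apply,
    plethysm_psum, smul_mul_assoc, perpLin_apply, ← perp_perp] using h

theorem skewH_one (t : K) (n : ℕ) : skewH t (n + 1) 1 = 0 := by
  have h0 : ((n + 1 : ℕ) : K) ≠ 0 := Nat.cast_ne_zero.mpr (Nat.succ_ne_zero n)
  refine (smul_eq_zero.mp ?_).resolve_left h0
  rw [newton_skewH]
  refine Finset.sum_eq_zero fun p _ => ?_
  rw [perp_psum_skewH, perp_psum_one, map_zero, smul_zero]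

/-- The coproduct rule for h_a[X(t-1)]^⊥, with h_i[X(t-1)]^⊥ h_n = h_i[t-1] h_{n-i}. In the
induction the Leibniz rule splits the Newton sum in two: F, where p^⊥ hits h_n, and G, where it hits
g. Newton's identities for the scalars and for `skewH` resum these with weights i and j, where i + j
= a + 1. -/
theorem skewH_hsumInt_mul (t : K) (a : ℕ) (n : ℤ) (g : SymFun K) :
    skewH t a (hsumInt K n * g) =
      ∑ p ∈ antidiagonal a, hsumScalar t p.1 • (hsumInt K (n - p.1) * skewH t p.2 g) := by
  induction a using Nat.strong_induction_on with
  | _ a ih =>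
    rcases a with _ | a
    · simp [skewH_zero, hsumScalar]
    have h0 : ((a + 1 : ℕ) : K) ≠ 0 := Nat.cast_ne_zero.mpr (Nat.succ_ne_zero a)
    refine smul_right_injective _ h0 ?_
    change ((a + 1 : ℕ) : K) • _ = ((a + 1 : ℕ) : K) • _
    rw [newton_skewH]
    let F : ℕ → ℕ → ℕ → SymFun K := fun r i j => ((t ^ (r + 1) - 1) * hsumScalar t i) •
      (hsumInt K (n - ((r + i : ℕ) + 1)) * skewH t j g)
    let G : ℕ → ℕ → ℕ → SymFun K := fun r i j => ((t ^ (r + 1) - 1) * hsumScalar t i) •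
      (hsumInt K (n - i) * perp (psum K (r + 1)) (skewH t j g))
    have e : ∀ p ∈ antidiagonal a, (t ^ (p.1 + 1) - 1) •
        perp (psum K (p.1 + 1)) (skewH t p.2 (hsumInt K n * g)) =
        ∑ q ∈ antidiagonal p.2, F p.1 q.1 q.2 + ∑ q ∈ antidiagonal p.2, G p.1 q.1 q.2 := by
      rintro ⟨r, b⟩ hp
      rw [mem_antidiagonal] at hp
      rw [ih b (by simp at hp; omega), ← Finset.sum_add_distrib, map_sum, Finset.smul_sum]
      refine Finset.sum_congr rfl fun q _ => ?_
      have hn : n - q.1 - (r + 1) = n - ((r + q.1 : ℕ) + 1) := by push_cast; ring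
      rw [map_smul, perp_psum_mul, perp_psum_hsumInt, smul_smul, smul_add, hn]
    rw [Finset.sum_congr rfl e, Finset.sum_add_distrib, sum_antidiagonal_assoc,
      sum_antidiagonal_left_comm a G]
    have e1 : ∑ p ∈ antidiagonal a, ∑ q ∈ antidiagonal p.1, F q.1 q.2 p.2 =
        ∑ p ∈ antidiagonal (a + 1), ((p.1 : K) * hsumScalar t p.1) •
          (hsumInt K (n - p.1) * skewH t p.2 g) := by
      rw [Finset.Nat.sum_antidiagonal_succ]
      simp only [Nat.cast_zero, zero_mul, zero_smul, zero_add]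
      refine Finset.sum_congr rfl fun p _ => ?_
      rw [newton_hsumScalar, Finset.sum_smul]
      refine Finset.sum_congr rfl fun q hq => ?_
      rw [mem_antidiagonal] at hq
      simp only [F, hq]
      push_cast; rfl
    have e2 : ∑ p ∈ antidiagonal a, ∑ q ∈ antidiagonal p.2, G q.1 p.1 q.2 =
        ∑ p ∈ antidiagonal (a + 1), ((p.2 : K) * hsumScalar t p.1) •
          (hsumInt K (n - p.1) * skewH t p.2 g) := by
      rw [Finset.Nat.sum_antidiagonal_succ']
      simp only [Nat.cast_zero, zero_mul, zero_smul, zero_add]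
      refine Finset.sum_congr rfl fun p _ => ?_
      rw [mul_comm, mul_smul, ← mul_smul_comm (((p.2 + 1 : ℕ)) : K), newton_skewH, Finset.mul_sum,
        Finset.smul_sum]
      refine Finset.sum_congr rfl fun q _ => ?_
      simp only [G]
      rw [mul_smul_comm, smul_smul, mul_comm (hsumScalar t _)]
    rw [e1, e2, ← Finset.sum_add_distrib, Finset.smul_sum]
    refine Finset.sum_congr rfl fun p hp => ?_
    rw [mem_antidiagonal] at hp
    rw [smul_smul, ← add_smul, ← hp]
    congr 1
    push_cast; ring

/-- The preceding expansion has kernel (1-z)/(1-tz); multiplying by 1-tz leaves only the two terms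
of 1-z. -/
theorem skewH_succ_hsumInt_mul (t : K) (a : ℕ) (n : ℤ) (g : SymFun K) :
    skewH t (a + 1) (hsumInt K n * g) - t • skewH t a (hsumInt K (n - 1) * g) =
      hsumInt K n * skewH t (a + 1) g - hsumInt K (n - 1) * skewH t a g := by
  rw [skewH_hsumInt_mul, skewH_hsumInt_mul, Finset.Nat.sum_antidiagonal_succ, add_sub_assoc,
    Finset.smul_sum, ← Finset.sum_sub_distrib, sub_eq_add_neg (hsumInt K n * _)]
  congr 1
  · simp [hsumScalar]
  · rw [Finset.sum_eq_single (0, a)]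
    · simp [hsumScalar, ← sub_smul]
    · rintro ⟨_ | i, j⟩ h hne
      · rw [mem_antidiagonal] at h
        simp at h
        exact absurd (by rw [h]) hne
      · simp only [hsumScalar, smul_smul]
        have : n - ((i + 1 + 1 : ℕ) : ℤ) = n - 1 - ((i + 1 : ℕ) : ℤ) := by push_cast; ring
        rw [this, ← sub_smul]
        convert zero_smul K _ using 2
        ring
    · intro h
      rw [mem_antidiagonal] at h
      simp at h

/-- Local finiteness, without a grading: on a product h_{i+1} g, either the index spent on h_{i+1}
exceeds i+1, or the index left for g is large. It makes the sum defining `vertexB` finite. -/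
theorem exists_skewH_eq_zero (t : K) (f : SymFun K) : ∃ N, ∀ n, N ≤ n → skewH t n f = 0 := by
  obtain ⟨q, rfl⟩ := hsumHom_surjective f
  induction q using MvPolynomial.induction_on with
  | C a =>
    refine ⟨1, fun n hn => ?_⟩
    obtain ⟨n, rfl⟩ := Nat.exists_eq_add_of_le' hn
    rw [MvPolynomial.algHom_C, Algebra.algebraMap_eq_smul_one, map_smul, skewH_one, smul_zero]
  | add p q hp hq =>
    obtain ⟨M, hM⟩ := hp
    obtain ⟨N, hN⟩ := hq
    refine ⟨max M N, fun n hn => ?_⟩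
    rw [map_add, map_add, hM n (by omega), hN n (by omega), add_zero]
  | mul_X p i hp =>
    obtain ⟨N, hN⟩ := hp
    refine ⟨N + (i + 2), fun n hn => ?_⟩
    rw [map_mul, hsumHom, MvPolynomial.aeval_X, mul_comm, ← hsumInt_natCast, skewH_hsumInt_mul]
    refine Finset.sum_eq_zero ?_
    rintro ⟨a, b⟩ h
    rw [mem_antidiagonal] at h
    simp only at h ⊢
    by_cases ha : i + 1 < a
    · rw [hsumInt_of_neg (by omega), zero_mul, smul_zero]
    · change _ • (_ * skewH t b (hsumHom K p)) = _
      rw [hN b (by omega), mul_zero, smul_zero]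

theorem vertexB_eq_sum (t : K) (l : ℤ) (f : SymFun K) {N : ℕ}
    (hN : ∀ n, N ≤ n → skewH t n f = 0) :
    vertexB t l f = ∑ i ∈ Finset.range N, hsumInt K (i + l) * skewH t i f := by
  refine finsum_eq_sum_of_support_subset _ fun i hi => ?_
  rw [Finset.coe_range, Set.mem_Iio]
  by_contra h
  refine hi ?_
  change _ * skewH t i f = 0
  rw [hN i (by omega), mul_zero]

/-- The vertex operator `B_l` as a linear map. -/
def vertexLin (t : K) (l : ℤ) : SymFun K →ₗ[K] SymFun K where
  toFun := vertexB t l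
  map_add' f g := by
    obtain ⟨M, hM⟩ := exists_skewH_eq_zero t f
    obtain ⟨N, hN⟩ := exists_skewH_eq_zero t g
    rw [vertexB_eq_sum t l f (N := max M N) fun n hn => hM n (by omega),
      vertexB_eq_sum t l g (N := max M N) fun n hn => hN n (by omega),
      vertexB_eq_sum t l (f + g) (N := max M N) fun n hn => by
        rw [map_add, hM n (by omega), hN n (by omega), add_zero],
      ← Finset.sum_add_distrib]
    simp only [map_add, mul_add]
  map_smul' c f := by
    obtain ⟨M, hM⟩ := exists_skewH_eq_zero t f
    rw [vertexB_eq_sum t l f hM, vertexB_eq_sum t l (c • f) fun n hn => by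
        rw [map_smul, hM n hn, smul_zero], Finset.smul_sum]
    simp only [map_smul, mul_smul_comm, RingHom.id_apply]

theorem vertexLin_apply (t : K) (l : ℤ) (f : SymFun K) : vertexLin t l f = vertexB t l f := rfl

theorem vertexB_one (t : K) (l : ℤ) : vertexB t l 1 = hsumInt K l := by
  rw [vertexB_eq_sum t l 1 (N := 1) fun n hn => by
    obtain ⟨n, rfl⟩ := Nat.exists_eq_add_of_le' hn
    exact skewH_one t n]
  simp [skewH_zero]

/-- N m n is the normally ordered product, with all multiplications to the left of all skewings; it
is symmetric because each kind commutes. The combination B_m B_n - t B_{m+1} B_{n-1} is the one for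
which `skewH_succ_hsumInt_mul` clears the denominator 1-tz. -/
theorem exists_normalOrder (t : K) (f : SymFun K) : ∃ N : ℤ → ℤ → SymFun K,
    (∀ m n, N m n = N n m) ∧ ∀ m n,
      vertexB t m (vertexB t n f) - t • vertexB t (m + 1) (vertexB t (n - 1) f) =
        N m n - N (m + 1) (n - 1) := by
  obtain ⟨d, hd⟩ := exists_skewH_eq_zero t f
  refine ⟨fun m n => ∑ i ∈ Finset.range d, ∑ j ∈ Finset.range d,
    hsumInt K (i + m) * (hsumInt K (j + n) * skewH t i (skewH t j f)), fun m n => ?_,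
    fun m n => ?_⟩
  · beta_reduce
    rw [Finset.sum_comm]
    refine Finset.sum_congr rfl fun i _ => Finset.sum_congr rfl fun j _ => ?_
    rw [mul_left_comm, skewH_comm]
  · have hex : ∀ n : ℤ, ∃ M, ∀ j, ∀ i, M ≤ i → skewH t i (hsumInt K n * skewH t j f) = 0 := by
      intro n
      have : ∀ j, ∃ M, ∀ i, M ≤ i → skewH t i (hsumInt K n * skewH t j f) = 0 :=
        fun j => exists_skewH_eq_zero t _
      choose M hM using this
      refine ⟨∑ j ∈ Finset.range d, M j, fun j i hi => ?_⟩
      by_cases hj : j < d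
      · exact hM j i (le_trans (Finset.single_le_sum (f := M) (fun _ _ => Nat.zero_le _)
          (Finset.mem_range.mpr hj)) hi)
      · rw [hd j (by omega), mul_zero, map_zero]
    choose M hM using hex
    -- One bound R beyond which all outer skewings vanish, so every series below is a finite sum.
    obtain ⟨R, hR1, hR2⟩ : ∃ R, d ≤ R ∧ ∀ j < d, M (j + n) ≤ R ∧ M (j + (n - 1)) ≤ R := by
      refine ⟨d + ∑ j ∈ Finset.range d, (M (j + n) + M (j + (n - 1))), Nat.le_add_right _ _,
        fun j hj => ?_⟩
      have := Finset.single_le_sum (f := fun j : ℕ => M (j + n) + M (j + (n - 1)))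
        (fun _ _ => Nat.zero_le _) (Finset.mem_range.mpr hj)
      omega
    have expand : ∀ l n : ℤ, (∀ j < d, M (j + n) ≤ R) → vertexB t l (vertexB t n f) =
        ∑ j ∈ Finset.range d, ∑ i ∈ Finset.range (R + 1),
          hsumInt K (i + l) * skewH t i (hsumInt K (j + n) * skewH t j f) := by
      intro l n hn
      rw [vertexB_eq_sum t n f hd, ← vertexLin_apply, map_sum]
      refine Finset.sum_congr rfl fun j hj => ?_
      rw [vertexLin_apply, vertexB_eq_sum t l _ (N := R + 1)]
      intro i hi
      exact hM _ j i (le_trans (hn j (Finset.mem_range.mp hj)) (by omega))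
    rw [expand m n fun j hj => (hR2 j hj).1, expand (m + 1) (n - 1) fun j hj => (hR2 j hj).2]
    have swap : ∀ m n : ℤ, ∑ i ∈ Finset.range d, ∑ j ∈ Finset.range d,
        hsumInt K (i + m) * (hsumInt K (j + n) * skewH t i (skewH t j f)) =
        ∑ j ∈ Finset.range d, ∑ i ∈ Finset.range d,
          hsumInt K (i + m) * (hsumInt K (j + n) * skewH t i (skewH t j f)) :=
      fun _ _ => Finset.sum_comm
    beta_reduce
    rw [swap m n, swap (m + 1) (n - 1), Finset.smul_sum, ← Finset.sum_sub_distrib, ← Finset.sum_sub_distrib]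
    refine Finset.sum_congr rfl fun j hj => ?_
    have ext : ∀ l : ℤ, ∀ g, ∑ i ∈ Finset.range d,
        hsumInt K (i + l) * (g * skewH t i (skewH t j f)) =
        ∑ i ∈ Finset.range R, hsumInt K (i + l) * (g * skewH t i (skewH t j f)) := by
      intro l g
      refine Finset.sum_subset (Finset.range_mono hR1) fun i _ hi => ?_
      rw [Finset.mem_range] at hi
      rw [skewH_comm, hd i (by omega), map_zero, mul_zero, mul_zero]
    have ext' : ∀ l : ℤ, ∀ g, ∑ i ∈ Finset.range d,
        hsumInt K (i + l) * (g * skewH t i (skewH t j f)) =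
        ∑ i ∈ Finset.range (R + 1), hsumInt K (i + l) * (g * skewH t i (skewH t j f)) := by
      intro l g
      rw [ext, Finset.sum_range_succ, skewH_comm, hd R hR1, map_zero, mul_zero, mul_zero, add_zero]
    have hvan : ∑ i ∈ Finset.range (R + 1), hsumInt K (i + (m + 1)) *
        skewH t i (hsumInt K (j + (n - 1)) * skewH t j f) = ∑ i ∈ Finset.range R,
          hsumInt K (i + (m + 1)) * skewH t i (hsumInt K (j + (n - 1)) * skewH t j f) := by
      rw [Finset.sum_range_succ, hM _ j R (hR2 j (Finset.mem_range.mp hj)).2, mul_zero, add_zero]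
    -- The ranges R + 1 and R differ so that, after the i = 0 terms are split off and cancelled,
    -- index i + 1 of the (m, n) sums pairs with index i of the (m+1, n-1) sums.
    rw [ext', ext, hvan, Finset.sum_range_succ', Finset.sum_range_succ', Finset.smul_sum]
    simp only [skewH_zero, LinearMap.id_apply]
    rw [add_sub_right_comm, add_sub_right_comm, ← Finset.sum_sub_distrib,
      ← Finset.sum_sub_distrib]
    congr 1
    refine Finset.sum_congr rfl fun i _ => ?_
    have h1 : ((i + 1 : ℕ) : ℤ) + m = i + (m + 1) := by push_cast; ring
    have h2 : (j : ℤ) + (n - 1) = j + n - 1 := by ring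
    rw [h1, h2, ← mul_smul_comm, ← mul_sub, skewH_succ_hsumInt_mul, mul_sub]

/-- The commutation relation of the vertex operators. -/
theorem vertexB_vertexB (t : K) (m n : ℤ) (f : SymFun K) :
    vertexB t m (vertexB t n f) = t • vertexB t (m + 1) (vertexB t (n - 1) f) +
      t • vertexB t n (vertexB t m f) - vertexB t (n - 1) (vertexB t (m + 1) f) := by
  obtain ⟨N, hN, h⟩ := exists_normalOrder t f
  have h1 := h m n
  -- The substitution (m, n) ↦ (n-1, m+1) changes the sign of N m n - N (m+1) (n-1), by symmetry of
  -- N; adding the two relations eliminates N.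
  have h2 := h (n - 1) (m + 1)
  rw [sub_add_cancel, add_sub_cancel_right, hN n m, hN (n - 1)] at h2
  have h3 : vertexB t m (vertexB t n f) - t • vertexB t (m + 1) (vertexB t (n - 1) f) +
    (vertexB t (n - 1) (vertexB t (m + 1) f) - t • vertexB t n (vertexB t m f)) = 0 := by
    rw [h1, h2]; abel
  rw [← sub_eq_zero, ← h3]
  abel

/-- For n = m + 1 the general relation contains the left-hand side again on the right; collecting
terms leaves a factor 2, which is cancelled. -/
theorem vertexB_vertexB_succ (t : K) (m : ℤ) (f : SymFun K) :
    vertexB t m (vertexB t (m + 1) f) = t • vertexB t (m + 1) (vertexB t m f) := by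
  have h := vertexB_vertexB t m (m + 1) f
  rw [add_sub_cancel_right, eq_sub_iff_add_eq, ← two_smul K, ← two_smul K] at h
  exact smul_right_injective _ (two_ne_zero (α := K)) h

end Skew

/-! ### Dominance order on integer words -/

section Dominance

/-- The dominance preorder on integer sequences, by comparison of partial sums. -/
def Dom (α β : List ℤ) : Prop :=
  α.sum = β.sum ∧ ∀ i, (α.take i).sum ≤ (β.take i).sum

/-- Strict dominance of integer sequences. -/
def SDom (α β : List ℤ) : Prop := Dom α β ∧ ¬ Dom β α

theorem Dom.refl (α : List ℤ) : Dom α α := ⟨rfl, fun _ => le_rfl⟩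

theorem Dom.trans {α β γ : List ℤ} (h : Dom α β) (h' : Dom β γ) : Dom α γ :=
  ⟨h.1.trans h'.1, fun i => (h.2 i).trans (h'.2 i)⟩

theorem SDom.trans_dom {α β γ : List ℤ} (h : SDom α β) (h' : Dom β γ) : SDom α γ :=
  ⟨h.1.trans h', fun hc => h.2 (h'.trans hc)⟩

theorem SDom.trans {α β γ : List ℤ} (h : SDom α β) (h' : SDom β γ) : SDom α γ :=
  h.trans_dom h'.1

theorem Dom.append {α α' β β' : List ℤ} (hl : α.length = α'.length) (h : Dom α α')
    (h' : Dom β β') : Dom (α ++ β) (α' ++ β') := by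
  refine ⟨by rw [List.sum_append, List.sum_append, h.1, h'.1], fun i => ?_⟩
  rw [List.take_append, List.take_append, List.sum_append, List.sum_append, hl]
  exact add_le_add (h.2 _) (h'.2 _)

/-- When the first pieces have equal length and sum, partial sums split at the common cut. This is
what lets strictness survive concatenation. -/
theorem Dom.of_append {α α' β β' : List ℤ} (hl : α.length = α'.length) (hs : α.sum = α'.sum)
    (h : Dom (α ++ β) (α' ++ β')) : Dom α α' ∧ Dom β β' := by
  obtain ⟨h1, h2⟩ := h
  simp only [List.sum_append, List.take_append, hl] at h1 h2
  refine ⟨⟨hs, fun i => ?_⟩, by omega, fun i => ?_⟩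
  · rcases le_total i α.length with hi | hi
    · have := h2 i
      rw [← hl, Nat.sub_eq_zero_of_le hi] at this
      simpa using this
    · rw [List.take_of_length_le hi, List.take_of_length_le (hl ▸ hi), hs]
  · have := h2 (α'.length + i)
    rw [List.take_of_length_le (l := α) (by omega), List.take_of_length_le (l := α') (by omega),
      Nat.add_sub_cancel_left] at this
    omega

theorem Dom.append_sdom {α α' β β' : List ℤ} (hl : α.length = α'.length) (h : Dom α α')
    (h' : SDom β β') : SDom (α ++ β) (α' ++ β') :=
  ⟨h.append hl h'.1, fun hc => h'.2 (Dom.of_append hl.symm h.1.symm hc).2⟩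

theorem SDom.append_dom {α α' β β' : List ℤ} (hl : α.length = α'.length) (h : SDom α α')
    (h' : Dom β β') : SDom (α ++ β) (α' ++ β') :=
  ⟨h.1.append hl h', fun hc => h.2 (Dom.of_append hl.symm h.1.1.symm hc).1⟩

theorem SDom.cons (a : ℤ) {β β' : List ℤ} (h : SDom β β') : SDom (a :: β) (a :: β') :=
  Dom.append_sdom (α := [a]) rfl (Dom.refl _) h

theorem dom_swap {a b c d : ℤ} (β γ : List ℤ) (hac : a < c) (hs : c + d = a + b) :
    Dom (β ++ a :: b :: γ) (β ++ c :: d :: γ) := by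
  refine (Dom.refl β).append rfl ⟨by simp only [List.sum_cons]; omega, ?_⟩
  rintro (_ | _ | i)
  · simp
  · simp [hac.le]
  · simp only [List.take_succ_cons, List.sum_cons]; omega

/-- A trailing zero changes no partial sum. Such words also show that `Dom` is not antisymmetric, so
`SDom` must exclude the reverse comparison and not just equality. -/
theorem dom_append_zero (β : List ℤ) : Dom (β ++ [0]) β := by
  refine ⟨by simp, fun i => ?_⟩
  rw [List.take_append, List.sum_append]
  rcases i - β.length with _ | n <;> simp

/-- A list of natural numbers, seen as a sequence of integers. -/
def intList (l : List ℕ) : List ℤ := l.map fun a : ℕ => (a : ℤ)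

theorem intList_cons (a : ℕ) (l : List ℕ) : intList (a :: l) = (a : ℤ) :: intList l := rfl

theorem intList_sum (l : List ℕ) : (intList l).sum = (l.sum : ℕ) := by
  induction l with
  | nil => rfl
  | cons a l ih => rw [intList_cons, List.sum_cons, ih]; simp

theorem intList_take_sum (l : List ℕ) (i : ℕ) :
    ((intList l).take i).sum = ((l.take i).sum : ℕ) := by
  rw [intList, ← List.map_take]
  exact intList_sum _

/-- Partitions, as weakly decreasing lists of positive parts. -/
def IsPart (l : List ℕ) : Prop := l.Pairwise (· ≥ ·) ∧ ∀ a ∈ l, 0 < a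

/-- A statistic of partitions that decreases along the dominance order. -/
def coheight (l : List ℕ) : ℕ := ∑ i ∈ Finset.range l.sum, (l.sum - (l.take i).sum)

theorem length_le_sum {l : List ℕ} (h : ∀ a ∈ l, 0 < a) : l.length ≤ l.sum := by
  induction l with
  | nil => simp
  | cons a l ih =>
    have h1 := h a (by simp)
    have h2 := ih fun b hb => h b (by simp [hb])
    simp only [List.length_cons, List.sum_cons]; omega

theorem take_sum_le (l : List ℕ) (i : ℕ) : (l.take i).sum ≤ l.sum := by
  conv_rhs => rw [← List.take_append_drop i l, List.sum_append]
  exact Nat.le_add_right _ _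

theorem coheight_lt {l m : List ℕ} (hl : IsPart l) (h : SDom (intList l) (intList m)) :
    coheight m < coheight l := by
  obtain ⟨⟨h1, h2⟩, h3⟩ := h
  have hs : l.sum = m.sum := by rw [intList_sum, intList_sum] at h1; omega
  have h2' : ∀ i, (l.take i).sum ≤ (m.take i).sum := fun i => by
    have := h2 i
    rw [intList_take_sum, intList_take_sum] at this; omega
  obtain ⟨i, hi⟩ : ∃ i, (l.take i).sum < (m.take i).sum := by
    by_contra! hc
    refine h3 ⟨h1.symm, fun i => ?_⟩
    rw [intList_take_sum, intList_take_sum]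
    exact_mod_cast hc i
  -- Positive parts force the partial sums of l to reach the total by index l.sum, so a strict gap
  -- occurs within the range summed in `coheight`.
  have hin : i < l.sum := by
    by_contra! hc
    rw [List.take_of_length_le ((length_le_sum hl.2).trans hc), hs] at hi
    exact absurd (take_sum_le m i) (by omega)
  rw [coheight, coheight, ← hs]
  refine Finset.sum_lt_sum (fun j _ => Nat.sub_le_sub_left (h2' j) _)
    ⟨i, Finset.mem_range.mpr hin, ?_⟩
  have := take_sum_le m i
  omega

end Dominance

/-! ### Straightening words into partitions -/

section Straightening

/-- A weighted sum of the distances `k - x` of the entries `x` from the upper bound `k`. -/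
def wordWeight (k : ℤ) : List ℤ → ℤ
  | [] => 0
  | a :: l => (k - a) * (l.length + 1) + wordWeight k l

theorem wordWeight_nonneg {k : ℤ} {α : List ℤ} (h : ∀ x ∈ α, x ≤ k) : 0 ≤ wordWeight k α := by
  induction α with
  | nil => exact le_rfl
  | cons a l ih =>
    have h1 := h a (by simp)
    have h2 := ih fun b hb => h b (by simp [hb])
    have : 0 ≤ k - a := by omega
    rw [wordWeight]
    positivity

/-- Moving c - a units one place to the left lowers the weight by exactly c - a, since adjacent
weights differ by one. This is the termination measure of the straightening. -/
theorem wordWeight_swap (k : ℤ) {a b c d : ℤ} (β γ : List ℤ) (hac : a < c)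
    (hs : c + d = a + b) : wordWeight k (β ++ c :: d :: γ) < wordWeight k (β ++ a :: b :: γ) := by
  induction β with
  | nil =>
    obtain rfl : d = a + b - c := by omega
    simp only [List.nil_append, wordWeight, List.length_cons]
    push_cast
    linarith
  | cons x β ih =>
    simp only [List.cons_append, wordWeight, List.length_append, List.length_cons]
    linarith

theorem exists_ascent {α : List ℤ} (h : ¬ α.Pairwise (· ≥ ·)) :
    ∃ β γ a b, α = β ++ a :: b :: γ ∧ a < b := by
  induction α with
  | nil => simp at h
  | cons a l ih =>
    by_cases hl : l.Pairwise (· ≥ ·)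
    · rw [List.pairwise_cons] at h
      have : ∃ x ∈ l, a < x := by
        by_contra! hc
        exact h ⟨hc, hl⟩
      obtain ⟨x, hx, hax⟩ := this
      rcases l with _ | ⟨b, γ⟩
      · simp at hx
      refine ⟨[], γ, a, b, rfl, ?_⟩
      rcases List.mem_cons.mp hx with rfl | hx
      · exact hax
      · exact hax.trans_le ((List.pairwise_cons.mp hl).1 x hx)
    · obtain ⟨β, γ, x, b, rfl, hxb⟩ := ih hl
      exact ⟨a :: β, γ, x, b, rfl, hxb⟩

variable {S M : Type*} [CommRing S] [AddCommGroup M] [Module S M]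

/-- A weakly decreasing word is tidied from the right: a negative last entry kills it, a zero is
dropped, and a positive one means that the word already is a partition. -/
theorem sorted_word_mem_span (V : List ℤ → M) (h0 : ∀ β, V (β ++ [0]) = V β)
    (hneg : ∀ β x, x < 0 → V (β ++ [x]) = 0) (k : ℤ) (α : List ℤ) (hs : α.Pairwise (· ≥ ·))
    (hk : ∀ x ∈ α, x ≤ k) : V α ∈ Submodule.span S ((fun μ => V (intList μ)) ''
      {μ | IsPart μ ∧ (∀ a ∈ μ, (a : ℤ) ≤ k) ∧ Dom α (intList μ)}) := by
  induction α using List.reverseRecOn with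
  | nil =>
    exact Submodule.subset_span ⟨[], ⟨⟨by simp, by simp⟩, by simp, Dom.refl _⟩, rfl⟩
  | append_singleton β x ih =>
    rw [List.pairwise_append] at hs
    rcases lt_trichotomy x 0 with hx | rfl | hx
    · rw [hneg β x hx]; exact zero_mem _
    · rw [h0]
      refine Submodule.span_mono (Set.image_mono ?_) (ih hs.1 fun y hy => hk y (by simp [hy]))
      rintro μ ⟨h1, h2, h3⟩
      exact ⟨h1, h2, (dom_append_zero β).trans h3⟩
    · have hpos : ∀ y ∈ β ++ [x], 0 < y := fun y hy => by
        rw [List.mem_append, List.mem_singleton] at hy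
        rcases hy with hy | rfl
        · exact hx.trans_le (hs.2.2 y hy x (by simp))
        · exact hx
      have hα : intList ((β ++ [x]).map Int.toNat) = β ++ [x] := by
        rw [intList, List.map_map]
        conv_rhs => rw [← List.map_id (β ++ [x])]
        refine List.map_congr_left fun y hy => ?_
        exact Int.toNat_of_nonneg (hpos y hy).le
      refine Submodule.subset_span ⟨(β ++ [x]).map Int.toNat, ⟨⟨?_, ?_⟩, ?_, ?_⟩, ?_⟩
      · rw [List.pairwise_map]
        refine List.Pairwise.imp (fun h => Int.toNat_le_toNat h) (List.pairwise_append.mpr hs)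
      · intro a ha
        obtain ⟨y, hy, rfl⟩ := List.mem_map.mp ha
        have := hpos y hy
        omega
      · intro a ha
        obtain ⟨y, hy, rfl⟩ := List.mem_map.mp ha
        have := hpos y hy
        have := hk y hy
        omega
      · rw [hα]; exact Dom.refl _
      · simp only [hα]

/-- Straightening: if a word with an ascent can be rewritten with words whose earlier entry at
the ascent is larger, then every word is a combination of partitions that dominate it. -/
theorem word_mem_span (V : List ℤ → M) (h0 : ∀ β, V (β ++ [0]) = V β)
    (hneg : ∀ β x, x < 0 → V (β ++ [x]) = 0)
    (hswap : ∀ β γ a b, a < b → V (β ++ a :: b :: γ) ∈ Submodule.span S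
      {v | ∃ c d, a < c ∧ c ≤ b ∧ c + d = a + b ∧ v = V (β ++ c :: d :: γ)})
    (k : ℤ) (α : List ℤ) (hk : ∀ x ∈ α, x ≤ k) :
    V α ∈ Submodule.span S ((fun μ => V (intList μ)) ''
      {μ | IsPart μ ∧ (∀ a ∈ μ, (a : ℤ) ≤ k) ∧ Dom α (intList μ)}) := by
  induction hn : (wordWeight k α).toNat using Nat.strong_induction_on generalizing α with
  | _ n ih =>
    subst hn
    by_cases hs : α.Pairwise (· ≥ ·)
    · exact sorted_word_mem_span V h0 hneg k α hs hk
    obtain ⟨β, γ, a, b, rfl, hab⟩ := exists_ascent hs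
    refine Submodule.span_le.mpr ?_ (hswap β γ a b hab)
    rintro _ ⟨c, d, hac, hcb, hcd, rfl⟩
    have hb := hk b (by simp)
    have hk' : ∀ x ∈ β ++ c :: d :: γ, x ≤ k := by
      intro x hx
      simp only [List.mem_append, List.mem_cons] at hx
      rcases hx with hx | rfl | rfl | hx
      · exact hk x (by simp [hx])
      · omega
      · omega
      · exact hk x (by simp [hx])
    -- The bound c ≤ b keeps both new entries at most k, so the weight stays nonnegative while it
    -- strictly drops.
    have hw := wordWeight_swap k β γ hac hcd
    have hw0 := wordWeight_nonneg hk'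
    refine Submodule.span_mono (Set.image_mono ?_) (ih _ (by omega) _ hk' rfl)
    rintro μ ⟨h1, h2, h3⟩
    exact ⟨h1, h2, (dom_swap β γ hac hcd).trans h3⟩

end Straightening

/-! ### Unitriangular changes of basis over a well-founded relation -/

section Unitriangular

variable {S M ι : Type*} [CommRing S] [AddCommGroup M] [Module S M] {r : ι → ι → Prop}
  {h : ι → ℕ} {x y : ι → M}

/-- The inverse of a unitriangular matrix is unitriangular over the same ring: no division is
needed, so it applies over ℤ[t]. The height h only supports the induction. -/
theorem unitriangular_inverse (hr : ∀ a b c, r a b → r b c → r a c)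
    (hh : ∀ a b, r a b → h b < h a)
    (hxy : ∀ i, y i - x i ∈ Submodule.span S (x '' {j | r i j})) (i : ι) :
    x i - y i ∈ Submodule.span S (y '' {j | r i j}) := by
  induction hn : h i using Nat.strong_induction_on generalizing i with
  | _ n ih =>
    subst hn
    rw [← neg_sub, neg_mem_iff]
    refine Submodule.span_le.mpr ?_ (hxy i)
    rintro _ ⟨j, hj, rfl⟩
    have h1 : x j - y j ∈ Submodule.span S (y '' {l | r i l}) :=
      Submodule.span_mono (Set.image_mono fun l hl => hr _ _ _ hj hl) (ih _ (hh _ _ hj) j rfl)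
    have h2 : y j ∈ Submodule.span S (y '' {l | r i l}) := Submodule.subset_span ⟨j, hj, rfl⟩
    simpa using add_mem h1 h2

theorem span_image_le_of_unitriangular {T : Set ι} (hT : ∀ a b, r a b → a ∈ T → b ∈ T)
    (hxy : ∀ i, y i - x i ∈ Submodule.span S (x '' {j | r i j})) :
    Submodule.span S (y '' T) ≤ Submodule.span S (x '' T) := by
  rw [Submodule.span_le]
  rintro _ ⟨i, hi, rfl⟩
  have h1 := Submodule.span_mono (Set.image_mono fun j hj => hT i j hj hi) (hxy i)
  have h2 : x i ∈ Submodule.span S (x '' T) := Submodule.subset_span ⟨i, hi, rfl⟩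
  simpa using add_mem h1 h2

theorem span_image_eq_of_unitriangular (hr : ∀ a b c, r a b → r b c → r a c)
    (hh : ∀ a b, r a b → h b < h a) {T : Set ι} (hT : ∀ a b, r a b → a ∈ T → b ∈ T)
    (hxy : ∀ i, y i - x i ∈ Submodule.span S (x '' {j | r i j})) :
    Submodule.span S (y '' T) = Submodule.span S (x '' T) :=
  le_antisymm (span_image_le_of_unitriangular hT hxy)
    (span_image_le_of_unitriangular hT (unitriangular_inverse hr hh hxy))

theorem span_range_eq_of_unitriangular (hr : ∀ a b c, r a b → r b c → r a c)
    (hh : ∀ a b, r a b → h b < h a)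
    (hxy : ∀ i, y i - x i ∈ Submodule.span S (x '' {j | r i j})) :
    Submodule.span S (Set.range y) = Submodule.span S (Set.range x) := by
  rw [← Set.image_univ, ← Set.image_univ]
  exact span_image_eq_of_unitriangular hr hh (fun _ _ _ _ => trivial) hxy

end Unitriangular

/-- In a nontrivial relation among the y_j, choose i in the support of maximal height. Then x_i
occurs in no other y_j of the relation, nor in y_i - x_i, so x_i would lie in the span of the other
x's. -/
theorem linearIndependent_of_unitriangular {F M ι : Type*} [Field F] [AddCommGroup M]
    [Module F M] {r : ι → ι → Prop} {h : ι → ℕ} {x y : ι → M}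
    (hh : ∀ a b, r a b → h b < h a)
    (hxy : ∀ i, y i - x i ∈ Submodule.span F (x '' {j | r i j}))
    (hx : LinearIndependent F x) : LinearIndependent F y := by
  rw [linearIndependent_iff]
  intro l hl
  rw [Finsupp.linearCombination_apply, Finsupp.sum] at hl
  by_contra hne
  obtain ⟨i, hi, hmax⟩ := Finset.exists_max_image l.support h (Finsupp.support_nonempty_iff.mpr hne)
  have hmem : ∀ j ∈ l.support, r j i → False := fun j hj hji =>
    absurd (hh _ _ hji) (not_lt.mpr (hmax j hj))
  have key : ∀ j ∈ l.support, y j - x j ∈ Submodule.span F (x '' {i}ᶜ) := fun j hj =>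
    Submodule.span_mono (Set.image_mono fun m (hm : r j m) => by
      rintro rfl
      exact hmem j hj hm) (hxy j)
  have hsum : l i • x i ∈ Submodule.span F (x '' {i}ᶜ) := by
    classical
    have h1 : l i • y i + ∑ j ∈ l.support.erase i, l j • y j = 0 := by
      rw [Finset.add_sum_erase _ (fun j => l j • y j) hi]; exact hl
    have h2 : l i • x i = - (l i • (y i - x i)) - ∑ j ∈ l.support.erase i, l j • y j := by
      rw [eq_neg_of_add_eq_zero_right h1, smul_sub]; abel
    rw [h2]
    refine sub_mem (neg_mem (Submodule.smul_mem _ _ (key i hi))) (sum_mem fun j hj => ?_)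
    rw [Finset.mem_erase] at hj
    have hxj : x j ∈ Submodule.span F (x '' {i}ᶜ) := Submodule.subset_span ⟨j, hj.1, rfl⟩
    have := add_mem (key j hj.2) hxj
    rw [sub_add_cancel] at this
    exact Submodule.smul_mem _ _ this
  have hli : l i ≠ 0 := Finsupp.mem_support_iff.mp hi
  rw [Submodule.smul_mem_iff _ hli] at hsum
  exact hx.notMem_span_image (s := {i}ᶜ) (fun h => h rfl) hsum

/-! ### Products of complete functions indexed by words -/

section Words

theorem map_mem_of_mem_span {S M N : Type*} [CommRing S] [AddCommGroup M] [Module S M]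
    [AddCommGroup N] [Module S N] (f : M →ₗ[S] N) {s : Set M} {P : Submodule S N}
    (h : ∀ y ∈ s, f y ∈ P) {x : M} (hx : x ∈ Submodule.span S s) : f x ∈ P :=
  (Submodule.span_le (p := P.comap f)).mpr h hx

variable {K : Type*} [Field K]

/-- The ring `ℤ[t]` inside `K`. -/
abbrev intPoly (t : K) : Subalgebra ℤ K := (Polynomial.aeval (R := ℤ) t).range

/-- The element `t` of `ℤ[t]`. -/
def intPolyX (t : K) : intPoly t := ⟨t, Polynomial.X, by simp⟩

theorem intPolyX_smul (t : K) (f : SymFun K) : intPolyX t • f = t • f := rfl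

/-- The product `h_{α₁} ⋯ h_{α_m}`. -/
def hsumWord (K : Type*) [Field K] (α : List ℤ) : SymFun K := (α.map (hsumInt K)).prod

theorem hsumWord_cons (a : ℤ) (α : List ℤ) :
    hsumWord K (a :: α) = hsumInt K a * hsumWord K α := by simp [hsumWord]

theorem hsumWord_append (α β : List ℤ) :
    hsumWord K (α ++ β) = hsumWord K α * hsumWord K β := by simp [hsumWord]

/-- Straightening for a commutative product: an ascent is simply exchanged. -/
theorem hsumWord_mem_span (k : ℤ) (α : List ℤ) (hk : ∀ x ∈ α, x ≤ k) :
    hsumWord K α ∈ Submodule.span K ((fun μ => hsumWord K (intList μ)) ''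
      {μ | IsPart μ ∧ (∀ a ∈ μ, (a : ℤ) ≤ k) ∧ Dom α (intList μ)}) := by
  refine word_mem_span _ (fun β => ?_) (fun β x hx => ?_) (fun β γ a b hab => ?_) k α hk
  · rw [hsumWord_append, hsumWord_cons]
    have : hsumInt K 0 = 1 := (hsumInt_natCast 0).trans hsum_zero
    rw [this]
    simp [hsumWord]
  · rw [hsumWord_append, hsumWord_cons, hsumInt_of_neg hx, zero_mul, mul_zero]
  · refine Submodule.subset_span ⟨b, a, hab, le_rfl, add_comm _ _, ?_⟩
    simp only [hsumWord_append, hsumWord_cons]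
    ring

theorem hsumWord_mem_span_part (α : List ℤ) :
    hsumWord K α ∈ Submodule.span K ((fun μ => hsumWord K (intList μ)) ''
      {μ | IsPart μ ∧ Dom α (intList μ)}) := by
  obtain ⟨k, hk⟩ : ∃ k, ∀ x ∈ α, x ≤ k := by
    obtain ⟨k, hk⟩ := α.toFinset.bddAbove
    exact ⟨k, fun x hx => hk (by simpa using hx)⟩
  refine Submodule.span_mono (Set.image_mono ?_) (hsumWord_mem_span k α hk)
  rintro μ ⟨h1, _, h2⟩
  exact ⟨h1, h2⟩

/-- Variable y_i stands for h_{i+1}, hence the predecessor of each part in the exponent. -/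
theorem hsumHom_monomial_part {l : List ℕ} (hl : ∀ a ∈ l, 0 < a) :
    hsumHom K (MvPolynomial.monomial (Multiset.toFinsupp (l.map Nat.pred : Multiset ℕ)) 1) =
      hsumWord K (intList l) := by
  induction l with
  | nil => simp [hsumWord, intList]
  | cons a l ih =>
    obtain ⟨a, rfl⟩ := Nat.exists_eq_add_of_le' (hl a (by simp))
    rw [intList_cons, hsumWord_cons, ← ih fun b hb => hl b (by simp [hb]), List.map_cons,
      ← Multiset.cons_coe, ← Multiset.singleton_add, map_add, Multiset.toFinsupp_singleton,
      hsumInt_natCast]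
    have : MvPolynomial.monomial (Finsupp.single (a + 1).pred 1 +
        Multiset.toFinsupp (l.map Nat.pred : Multiset ℕ)) (1 : K) =
        MvPolynomial.X a * MvPolynomial.monomial (Multiset.toFinsupp
          (l.map Nat.pred : Multiset ℕ)) 1 := by
      rw [MvPolynomial.X, MvPolynomial.monomial_mul, one_mul]; rfl
    rw [this, map_mul]
    congr 1
    exact MvPolynomial.aeval_X _ _

theorem linearIndependent_hsumWord [CharZero K] :
    LinearIndependent K fun l : {l : List ℕ // IsPart l} => hsumWord K (intList l.1) := by
  have hinj : Function.Injective fun l : {l : List ℕ // IsPart l} =>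
      Multiset.toFinsupp (l.1.map Nat.pred : Multiset ℕ) := by
    rintro ⟨l, hl⟩ ⟨m, hm⟩ h
    have h1 : (l.map Nat.pred).Perm (m.map Nat.pred) :=
      Multiset.coe_eq_coe.mp (Multiset.toFinsupp.injective h)
    have h2 := h1.map Nat.succ
    have e : ∀ l : List ℕ, (∀ a ∈ l, 0 < a) → (l.map Nat.pred).map Nat.succ = l := by
      intro l hl
      rw [List.map_map]
      conv_rhs => rw [← List.map_id l]
      exact List.map_congr_left fun a ha => Nat.succ_pred_eq_of_pos (hl a ha)
    rw [e l hl.2, e m hm.2] at h2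
    exact Subtype.ext (h2.eq_of_pairwise (fun _ _ _ _ h h' => le_antisymm h' h) hl.1 hm.1)
  have h := ((MvPolynomial.basisMonomials ℕ K).linearIndependent.comp _ hinj).map'
    (hsumHom K).toLinearMap (LinearMap.ker_eq_bot.mpr hsumHom_injective)
  have e : (fun l : {l : List ℕ // IsPart l} => hsumWord K (intList l.1)) =
      (hsumHom K).toLinearMap ∘ MvPolynomial.basisMonomials ℕ K ∘ fun l =>
        Multiset.toFinsupp (l.1.map Nat.pred : Multiset ℕ) := by
    funext l
    rw [← hsumHom_monomial_part l.2.2]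
    simp
  rw [e]
  exact h

end Words

/-! ### Words in vertex operators: straightening and comparison with `h`-words -/

section VertexWords

variable {K : Type*} [Field K] [CharZero K]

/-- The composition `B_{α₁} ⋯ B_{α_m}` as a linear map. -/
def vertexSeqLin (t : K) (α : List ℤ) : SymFun K →ₗ[K] SymFun K :=
  α.foldr (fun l g => vertexLin t l ∘ₗ g) LinearMap.id

theorem vertexSeqLin_apply (t : K) (α : List ℤ) (f : SymFun K) :
    vertexSeqLin t α f = vertexBSeq t α f := by
  induction α with
  | nil => rfl
  | cons a α ih =>
    change vertexLin t a (vertexSeqLin t α f) = _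
    rw [ih]; rfl

theorem vertexBSeq_append (t : K) (α β : List ℤ) (f : SymFun K) :
    vertexBSeq t (α ++ β) f = vertexBSeq t α (vertexBSeq t β f) := by
  simp [vertexBSeq, List.foldr_append]

theorem vertexBSeq_cons (t : K) (a : ℤ) (β : List ℤ) (f : SymFun K) :
    vertexBSeq t (a :: β) f = vertexB t a (vertexBSeq t β f) := rfl

theorem hallLittlewood_eq (t : K) (l : List ℕ) :
    hallLittlewood t l = vertexBSeq t (intList l) 1 := by
  simp [hallLittlewood, intList, List.map_eq_flatMap]

/-- The central straightening statement. Its coefficients lie in ℤ[t] because those of the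
commutation relation are 1, -1 and t; the boundary rules come from B_x·1 = h_x. -/
theorem vertexBSeq_mem_span (t : K) (k : ℤ) (α : List ℤ) (hk : ∀ x ∈ α, x ≤ k) :
    vertexBSeq t α 1 ∈ Submodule.span (intPoly t) ((fun μ => vertexBSeq t (intList μ) 1) ''
      {μ | IsPart μ ∧ (∀ a ∈ μ, (a : ℤ) ≤ k) ∧ Dom α (intList μ)}) := by
  refine word_mem_span (S := intPoly t) (fun α => vertexBSeq t α 1) (fun β => ?_)
    (fun β x hx => ?_) (fun β γ a b hab => ?_) k α hk
  · have : hsumInt K 0 = 1 := (hsumInt_natCast 0).trans hsum_zero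
    simp only [vertexBSeq_append, vertexBSeq_cons]
    change vertexBSeq t β (vertexB t 0 1) = _
    rw [vertexB_one, this]
  · simp only [vertexBSeq_append, vertexBSeq_cons]
    change vertexBSeq t β (vertexB t x 1) = _
    rw [vertexB_one, hsumInt_of_neg hx, ← vertexSeqLin_apply, map_zero]
  · have hsub : ∀ c d, a < c → c ≤ b → c + d = a + b →
        vertexBSeq t (β ++ c :: d :: γ) 1 ∈ Submodule.span (intPoly t)
          {v | ∃ c d, a < c ∧ c ≤ b ∧ c + d = a + b ∧ v = vertexBSeq t (β ++ c :: d :: γ) 1} :=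
      fun c d h1 h2 h3 => Submodule.subset_span ⟨c, d, h1, h2, h3, rfl⟩
    have hexp : ∀ c d, vertexBSeq t (β ++ c :: d :: γ) 1 =
        vertexSeqLin t β (vertexB t c (vertexB t d (vertexBSeq t γ 1))) := fun c d => by
      rw [vertexSeqLin_apply, vertexBSeq_append]; rfl
    -- For b = a + 1 the general relation would reproduce the word itself; for larger gaps its three
    -- terms all have first entry in (a, b].
    by_cases h : b = a + 1
    · subst h
      have := Submodule.smul_mem _ (intPolyX t) (hsub (a + 1) a (by omega) le_rfl (by omega))
      rwa [intPolyX_smul, hexp, ← map_smul, ← vertexB_vertexB_succ, ← hexp] at this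
    · have h1 := Submodule.smul_mem _ (intPolyX t)
        (hsub (a + 1) (b - 1) (by omega) (by omega) (by omega))
      have h2 := Submodule.smul_mem _ (intPolyX t) (hsub b a hab le_rfl (by omega))
      have h3 := hsub (b - 1) (a + 1) (by omega) (by omega) (by omega)
      have := sub_mem (add_mem h1 h2) h3
      rwa [intPolyX_smul, intPolyX_smul, hexp, hexp, hexp, ← map_smul, ← map_smul, ← map_add,
        ← map_sub, ← vertexB_vertexB, ← hexp] at this

/-- Skewing removes n boxes in all, so no partial sum falls by more than n. -/
theorem skewH_hsumWord_mem (t : K) (n : ℕ) (α : List ℤ) :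
    skewH t n (hsumWord K α) ∈ Submodule.span K (hsumWord K ''
      {β | β.sum = α.sum - n ∧ ∀ i, (α.take i).sum - n ≤ (β.take i).sum}) := by
  induction α generalizing n with
  | nil =>
    have h1 : hsumWord K [] = 1 := rfl
    rw [h1]
    rcases n with _ | n
    · rw [skewH_zero]
      exact Submodule.subset_span ⟨[], ⟨by simp, by simp⟩, h1⟩
    · rw [skewH_one]; exact zero_mem _
  | cons m α ih =>
    rw [hsumWord_cons, skewH_hsumInt_mul]
    refine sum_mem fun p hp => Submodule.smul_mem _ _ ?_
    rw [mem_antidiagonal] at hp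
    refine map_mem_of_mem_span (LinearMap.mulLeft K (hsumInt K (m - p.1))) ?_ (ih p.2)
    rintro _ ⟨β, ⟨h1, h2⟩, rfl⟩
    refine Submodule.subset_span ⟨(m - p.1) :: β, ⟨?_, ?_⟩, hsumWord_cons _ _⟩
    · simp only [List.sum_cons]; omega
    · rintro (_ | i)
      · simp
      · have := h2 i
        simp only [List.take_succ_cons, List.sum_cons]; omega

/-- The i = 0 term is the h-word with a prepended. For i > 0 the first entry gains i while the rest
loses at most i in any partial sum, so the word dominates strictly, already at its first entry. -/
theorem vertexB_hsumWord_mem (t : K) (a : ℤ) (α : List ℤ) :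
    vertexB t a (hsumWord K α) - hsumWord K (a :: α) ∈ Submodule.span K (hsumWord K ''
      {γ | SDom (a :: α) γ}) := by
  obtain ⟨N, hN⟩ := exists_skewH_eq_zero t (hsumWord K α)
  rw [vertexB_eq_sum t a _ (N := N + 1) fun n hn => hN n (by omega), Finset.sum_range_succ',
    skewH_zero, hsumWord_cons]
  simp only [Nat.cast_zero, zero_add, LinearMap.id_apply, add_sub_cancel_right]
  refine sum_mem fun i _ => ?_
  refine map_mem_of_mem_span (LinearMap.mulLeft K (hsumInt K (((i + 1 : ℕ) : ℤ) + a))) ?_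
    (skewH_hsumWord_mem t (i + 1) α)
  rintro _ ⟨β, ⟨h1, h2⟩, rfl⟩
  refine Submodule.subset_span ⟨(((i + 1 : ℕ) : ℤ) + a) :: β, ⟨⟨?_, ?_⟩, fun hc => ?_⟩,
    hsumWord_cons _ _⟩
  · simp only [List.sum_cons]; omega
  · rintro (_ | i)
    · simp
    · have := h2 i
      simp only [List.take_succ_cons, List.sum_cons]; omega
  · have := hc.2 1
    simp only [List.take_succ_cons, List.take_zero, List.sum_cons, List.sum_nil] at this
    omega

theorem vertexBSeq_sub_hsumWord_mem (t : K) (α : List ℤ) :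
    vertexBSeq t α 1 - hsumWord K α ∈ Submodule.span K (hsumWord K '' {γ | SDom α γ}) := by
  induction α with
  | nil =>
    have h1 : hsumWord K [] = 1 := rfl
    rw [h1]
    change (1 : SymFun K) - 1 ∈ _
    rw [sub_self]; exact zero_mem _
  | cons a α ih =>
    rw [vertexBSeq_cons]
    have h1 := vertexB_hsumWord_mem t a α
    have h2 : vertexLin t a (vertexBSeq t α 1 - hsumWord K α) ∈
        Submodule.span K (hsumWord K '' {γ | SDom (a :: α) γ}) := by
      refine map_mem_of_mem_span _ ?_ ih
      rintro _ ⟨γ, hγ, rfl⟩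
      have h3 : hsumWord K (a :: γ) ∈ Submodule.span K (hsumWord K '' {γ | SDom (a :: α) γ}) :=
        Submodule.subset_span ⟨_, SDom.cons a hγ, rfl⟩
      have h4 := Submodule.span_mono (Set.image_mono fun δ (hδ : SDom (a :: γ) δ) =>
        (SDom.cons a hγ).trans hδ) (vertexB_hsumWord_mem t a γ)
      rw [vertexLin_apply]
      have h5 := add_mem h4 h3
      rwa [sub_add_cancel] at h5
    rw [map_sub, vertexLin_apply, vertexLin_apply] at h2
    simpa using add_mem h2 h1

theorem linearIndependent_hallLittlewood (t : K) :
    LinearIndependent K fun l : {l : List ℕ // IsPart l} => hallLittlewood t l.1 := by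
  refine linearIndependent_of_unitriangular
    (r := fun l m : {l : List ℕ // IsPart l} => SDom (intList l.1) (intList m.1))
    (h := fun l => coheight l.1) (fun l m h => coheight_lt l.2 h) (fun l => ?_)
    linearIndependent_hsumWord
  rw [hallLittlewood_eq]
  refine Submodule.span_le.mpr ?_ (vertexBSeq_sub_hsumWord_mem t (intList l.1))
  rintro _ ⟨γ, hγ, rfl⟩
  refine Submodule.span_mono ?_ (hsumWord_mem_span_part γ)
  rintro _ ⟨μ, ⟨h1, h2⟩, rfl⟩
  exact ⟨⟨μ, h1⟩, SDom.trans_dom hγ h2, rfl⟩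

end VertexWords

/-! ### Raising operators and dominance -/

section Raising

theorem intList_eq_ofFn (l : List ℕ) :
    intList l = List.ofFn fun r : Fin l.length => (l.get r : ℤ) := by
  refine List.ext_getElem (by simp [intList]) fun i h1 h2 => ?_
  simp [intList]

theorem length_raise (l : List ℕ) (A : Finset (Fin l.length × Fin l.length)) :
    (raise l A).length = (intList l).length := by simp [raise, intList]

theorem raise_empty (l : List ℕ) : raise l ∅ = intList l := by
  rw [intList_eq_ofFn]; simp [raise]

/-- Reduces dominance to counting: among the pairs in A, those starting before i against those
ending before i. -/
theorem raise_take_sum (l : List ℕ) (A : Finset (Fin l.length × Fin l.length)) (i : ℕ) :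
    ((raise l A).take i).sum = ((intList l).take i).sum +
      (A.filter fun p => p.1.val < i).card - (A.filter fun p => p.2.val < i).card := by
  have key : ∀ f : Fin l.length × Fin l.length → Fin l.length,
      (A.filter fun p => (f p).val < i).card =
        ∑ r : Fin l.length with r.val < i, (A.filter fun p => f p = r).card := by
    intro f
    rw [Finset.card_eq_sum_card_fiberwise (f := f)
      (t := Finset.univ.filter fun r : Fin l.length => r.val < i) fun p hp => by simpa using
        (Finset.mem_filter.mp hp).2]
    refine Finset.sum_congr rfl fun r hr => ?_
    rw [Finset.filter_filter]
    congr 1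
    refine Finset.filter_congr fun p _ => ?_
    rw [Finset.mem_filter] at hr
    exact ⟨fun h => h.2, fun h => ⟨h ▸ hr.2, h⟩⟩
  rw [key, key, raise, intList_eq_ofFn, List.sum_take_ofFn, List.sum_take_ofFn]
  push_cast
  rw [← Finset.sum_add_distrib, ← Finset.sum_sub_distrib]

theorem dom_raise (l : List ℕ) (A : Finset (Fin l.length × Fin l.length))
    (hA : ∀ p ∈ A, p.1 < p.2) : Dom (intList l) (raise l A) := by
  constructor
  · have h := raise_take_sum l A l.length
    rw [List.take_of_length_le (by simp [raise]), List.take_of_length_le (by simp [intList])] at h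
    simp [h]
  · intro i
    rw [raise_take_sum]
    have : (A.filter fun p => p.2.val < i).card ≤ (A.filter fun p => p.1.val < i).card := by
      refine Finset.card_le_card fun p hp => ?_
      rw [Finset.mem_filter] at hp ⊢
      exact ⟨hp.1, lt_trans (hA p hp.1) hp.2⟩
    omega

theorem sdom_raise (l : List ℕ) (A : Finset (Fin l.length × Fin l.length))
    (hA : ∀ p ∈ A, p.1 < p.2) (hne : A.Nonempty) : SDom (intList l) (raise l A) := by
  refine ⟨dom_raise l A hA, fun hc => ?_⟩
  obtain ⟨q, hq⟩ := hne
  -- Cutting just before the second index of q separates its two ends, so q is counted once with a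
  -- plus sign and not with a minus.
  have h := hc.2 q.2
  rw [raise_take_sum] at h
  have : (A.filter fun p => p.2.val < q.2.val).card <
      (A.filter fun p => p.1.val < q.2.val).card := by
    refine Finset.card_lt_card ((Finset.ssubset_iff_of_subset fun p hp => ?_).mpr ⟨q, ?_, ?_⟩)
    · rw [Finset.mem_filter] at hp ⊢
      exact ⟨hp.1, lt_trans (hA p hp.1) hp.2⟩
    · rw [Finset.mem_filter]
      exact ⟨hq, hA q hq⟩
    · simp
  omega

/-- An entry is raised at most once for each other position, so by at most the number of parts minus
one. The hypothesis says that the hook length stays at most k; this is where the size of the k-split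
blocks enters. -/
theorem raise_le {l : List ℕ} {k : ℕ} (hl : ∀ a ∈ l, a + l.length ≤ k + 1)
    (A : Finset (Fin l.length × Fin l.length)) (hA : ∀ p ∈ A, p.1 < p.2) :
    ∀ x ∈ raise l A, x ≤ k := by
  intro x hx
  rw [raise, List.mem_ofFn] at hx
  obtain ⟨r, rfl⟩ := hx
  have h1 := hl (l.get r) (List.get_mem _ _)
  have h2 : (A.filter fun p => p.1 = r).card ≤ (Finset.univ.erase r).card := by
    refine Finset.card_le_card_of_injOn Prod.snd (fun p hp => ?_) fun p hp q hq h => ?_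
    · rw [Finset.mem_coe, Finset.mem_filter] at hp
      rw [Finset.mem_coe, Finset.mem_erase]
      exact ⟨fun h => (hA p hp.1).ne (hp.2.trans h.symm), Finset.mem_univ _⟩
    · rw [Finset.mem_coe, Finset.mem_filter] at hp hq
      exact Prod.ext (hp.2.trans hq.2.symm) h
  rw [Finset.card_erase_of_mem (Finset.mem_univ r), Finset.card_univ, Fintype.card_fin] at h2
  have h3 := r.pos
  omega

theorem domLT_of_sdom {l m : List ℕ} (h : SDom (intList l) (intList m)) : DomLT l m := by
  refine ⟨?_, fun i => ?_, ?_⟩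
  · have := h.1.1
    rw [intList_sum, intList_sum] at this
    exact_mod_cast this
  · have := h.1.2 i
    rw [intList_take_sum, intList_take_sum] at this
    exact_mod_cast this
  · rintro rfl
    exact h.2 (Dom.refl _)

end Raising

/-! ### Projections, bases and coefficients in `ℤ[t]` -/

section Coefficients

theorem linearCombination_filter {ι F V : Type*} [Field F] [AddCommGroup V] [Module F V]
    (v : ι → V) (p : ι → Prop) [DecidablePred p] (Q : V →ₗ[F] V)
    (h1 : ∀ m, p m → Q (v m) = v m) (h2 : ∀ m, ¬ p m → Q (v m) = 0) (c : ι →₀ F) :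
    Finsupp.linearCombination F v (c.filter p) = Q (Finsupp.linearCombination F v c) := by
  induction c using Finsupp.induction_linear with
  | zero => rw [Finsupp.filter_zero, map_zero, map_zero]
  | add c d hc hd => rw [Finsupp.filter_add, map_add, map_add, map_add, hc, hd]
  | single m a =>
    rw [Finsupp.linearCombination_single, map_smul]
    by_cases h : p m
    · rw [Finsupp.filter_single_of_pos _ h, Finsupp.linearCombination_single, h1 m h]
    · rw [Finsupp.filter_single_of_neg _ h, map_zero, h2 m h, smul_zero]

theorem exists_basis_of_span_eq {ι F V : Type*} [Field F] [AddCommGroup V] [Module F V]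
    {v : ι → V} {P : Submodule F V} (hv : LinearIndependent F v)
    (hP : Submodule.span F (Set.range v) = P) :
    ∃ b : Module.Basis ι F P, ∀ i, (b i : V) = v i := by
  subst hP
  exact ⟨Module.Basis.span hv, fun i => congrArg Subtype.val (Module.Basis.span_apply hv i)⟩

variable {K : Type*} [Field K]

theorem neg_intPolyX_pow_smul (t : K) (n : ℕ) (f : SymFun K) :
    (-intPolyX t) ^ n • f = (-t) ^ n • f := by
  rw [Subalgebra.smul_def]
  rfl

theorem span_intPoly_le (t : K) {s : Set (SymFun K)} {f : SymFun K}
    (h : f ∈ Submodule.span (intPoly t) s) : f ∈ Submodule.span K s :=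
  Submodule.span_subset_span (intPoly t) K s h

theorem exists_polynomial_coeffs (t : K) {ι : Type*} {v : ι → SymFun K} {s : Set ι}
    {f : SymFun K} (hf : f ∈ Submodule.span (intPoly t) (v '' s)) :
    ∃ u : ι →₀ Polynomial ℤ, (∀ i ∈ u.support, i ∈ s) ∧
      f = u.sum fun i c => Polynomial.aeval t c • v i := by
  rw [Finsupp.mem_span_image_iff_linearCombination] at hf
  obtain ⟨c, hc, rfl⟩ := hf
  -- A lift of coefficients to polynomials, normalized to send 0 to 0 so that it acts on finitely
  -- supported functions.
  obtain ⟨g, hg0, hg⟩ : ∃ g : intPoly t → Polynomial ℤ, g 0 = 0 ∧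
      ∀ x, Polynomial.aeval t (g x) = (x : K) := by
    classical
    choose g hg using fun x : intPoly t => x.2
    refine ⟨fun x => if x = 0 then 0 else g x, if_pos rfl, fun x => ?_⟩
    dsimp only
    split_ifs with h
    · rw [h, map_zero]; rfl
    · exact hg x
  refine ⟨c.mapRange g hg0, fun i hi => hc (Finsupp.support_mapRange hi), ?_⟩
  rw [Finsupp.sum_mapRange_index fun i => by rw [map_zero, zero_smul],
    Finsupp.linearCombination_apply]
  refine Finsupp.sum_congr fun i _ => ?_
  rw [hg]
  rfl

end Coefficients

/-! ### The `k`-split polynomials as a basis -/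

section SplitPolynomials

variable {K : Type*} [Field K] [CharZero K]

/-- The operator `B_λ` as a linear map. -/
def vertexPartLin (t : K) (l : List ℕ) : SymFun K →ₗ[K] SymFun K :=
  ∑ A ∈ (Finset.univ.filter fun p : Fin l.length × Fin l.length => p.1 < p.2).powerset,
    (-t) ^ A.card • vertexSeqLin t (raise l A)

theorem vertexPartLin_apply (t : K) (l : List ℕ) (f : SymFun K) :
    vertexPartLin t l f = vertexBPart t l f := by
  simp [vertexPartLin, vertexBPart, vertexSeqLin_apply]

/-- The empty set of raising operators gives the leading word; every nonempty set gives a strictly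
higher word whose entries are still at most k. -/
theorem vertexPartLin_word_sub_mem (t : K) (k : ℕ) {l : List ℕ}
    (hl : ∀ a ∈ l, a + l.length ≤ k + 1) {α : List ℤ} (hα : ∀ x ∈ α, x ≤ k) :
    vertexPartLin t l (vertexBSeq t α 1) - vertexBSeq t (intList l ++ α) 1 ∈
      Submodule.span (intPoly t) ((fun γ => vertexBSeq t γ 1) ''
        {γ | (∀ x ∈ γ, x ≤ k) ∧ SDom (intList l ++ α) γ}) := by
  rw [vertexPartLin_apply, vertexBPart, ← Finset.add_sum_erase _ _
    (Finset.empty_mem_powerset _), raise_empty, Finset.card_empty, pow_zero, one_smul,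
    vertexBSeq_append, add_sub_cancel_left]
  refine sum_mem fun A hA => ?_
  rw [Finset.mem_erase, Finset.mem_powerset] at hA
  have hA' : ∀ p ∈ A, p.1 < p.2 := fun p hp => (Finset.mem_filter.mp (hA.2 hp)).2
  rw [← neg_intPolyX_pow_smul, ← vertexBSeq_append]
  refine Submodule.smul_mem _ _ (Submodule.subset_span ⟨raise l A ++ α, ⟨fun x hx => ?_, ?_⟩, rfl⟩)
  · rcases List.mem_append.mp hx with h | h
    · exact raise_le hl A hA' x h
    · exact hα x h
  · exact (sdom_raise l A hA' (Finset.nonempty_iff_ne_empty.mpr hA.1)).append_dom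
      (length_raise l A).symm (Dom.refl α)

/-- Induction over the blocks. The error terms are kept as unstraightened words, since prefixing a
block to a word need not give a partition; only the bound k on the entries has to be carried along.
-/
theorem kSplitPoly_sub_word_mem (t : K) (k : ℕ) (l : List ℕ) (hs : l.Pairwise (· ≥ ·))
    (hk : ∀ a ∈ l, a ≤ k) : kSplitPoly t k l - vertexBSeq t (intList l) 1 ∈
      Submodule.span (intPoly t) ((fun γ => vertexBSeq t γ 1) ''
        {γ | (∀ x ∈ γ, x ≤ (k : ℤ)) ∧ SDom (intList l) γ}) := by
  induction hn : l.length using Nat.strong_induction_on generalizing l with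
  | _ n ih =>
    subst hn
    rcases l with _ | ⟨a, l⟩
    · rw [kSplitPoly, kSplit]
      change (1 : SymFun K) - 1 ∈ _
      rw [sub_self]; exact zero_mem _
    set b := a :: l.take (k - a) with hb
    set l' := l.drop (k - a) with hl'
    have hcat : a :: l = b ++ l' := by simp [hb, hl']
    have hG : kSplitPoly t k (a :: l) = vertexPartLin t b (kSplitPoly t k l') := by
      rw [vertexPartLin_apply, kSplitPoly, kSplit]; rfl
    have hil : intList (a :: l) = intList b ++ intList l' := by
      rw [hcat, intList, List.map_append]; rfl
    have ha : a ≤ k := hk a (by simp)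
    have hbk : ∀ c ∈ b, c + b.length ≤ k + 1 := by
      intro c hc
      have hca : c ≤ a := by
        rcases List.mem_cons.mp hc with rfl | hc
        · exact le_rfl
        · exact (List.pairwise_cons.mp hs).1 c (List.mem_of_mem_take hc)
      have : b.length ≤ k - a + 1 := by simp [hb]
      omega
    have hl'k : ∀ c ∈ l', c ≤ k := fun c hc => hk c (by rw [hcat]; simp [hc])
    have hl'z : ∀ x ∈ intList l', x ≤ (k : ℤ) := by
      intro x hx
      obtain ⟨c, hc, rfl⟩ := List.mem_map.mp hx
      exact_mod_cast hl'k c hc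
    have hsub : l'.Pairwise (· ≥ ·) := by
      rw [hcat] at hs
      exact (List.pairwise_append.mp hs).2.1
    have h1 := ih l'.length (by simp [hl']) l' hsub hl'k rfl
    have h2 := vertexPartLin_word_sub_mem t k hbk hl'z
    rw [hG, hil]
    -- The error terms γ of the remaining blocks: prefixing b preserves strict dominance, and the
    -- new errors from B_b lie higher still.
    have h3 : vertexPartLin t b (kSplitPoly t k l' - vertexBSeq t (intList l') 1) ∈
        Submodule.span (intPoly t) ((fun γ => vertexBSeq t γ 1) ''
          {γ | (∀ x ∈ γ, x ≤ (k : ℤ)) ∧ SDom (intList b ++ intList l') γ}) := by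
      refine map_mem_of_mem_span ((vertexPartLin t b).restrictScalars (intPoly t)) ?_ h1
      rintro _ ⟨γ, ⟨hγ, hd⟩, rfl⟩
      have hd' : SDom (intList b ++ intList l') (intList b ++ γ) :=
        (Dom.refl (intList b)).append_sdom rfl hd
      have hT : {δ | (∀ x ∈ δ, x ≤ (k : ℤ)) ∧ SDom (intList b ++ γ) δ} ⊆
          {δ | (∀ x ∈ δ, x ≤ (k : ℤ)) ∧ SDom (intList b ++ intList l') δ} :=
        fun δ hδ => ⟨hδ.1, hd'.trans hδ.2⟩
      have h4 := Submodule.span_mono (Set.image_mono hT) (vertexPartLin_word_sub_mem t k hbk hγ)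
      have h5 : vertexBSeq t (intList b ++ γ) 1 ∈ Submodule.span (intPoly t)
          ((fun γ => vertexBSeq t γ 1) ''
            {γ | (∀ x ∈ γ, x ≤ (k : ℤ)) ∧ SDom (intList b ++ intList l') γ}) := by
        refine Submodule.subset_span ⟨_, ⟨fun x hx => ?_, hd'⟩, rfl⟩
        rcases List.mem_append.mp hx with h | h
        · obtain ⟨c, hc, rfl⟩ := List.mem_map.mp h
          have := hk c (by rw [hcat]; simp [hc])
          exact_mod_cast this
        · exact hγ x h
      have h6 := add_mem h4 h5
      rwa [sub_add_cancel] at h6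
    have h7 := add_mem h3 h2
    rwa [map_sub, sub_add_sub_cancel] at h7

/-- The order on `k`-bounded partitions by strict dominance. -/
def KBounded.SDom {k : ℕ} (l m : KBounded k) : Prop := KSchur.SDom (intList l.1) (intList m.1)

theorem KBounded.isPart {k : ℕ} (l : KBounded k) : IsPart l.1 :=
  ⟨l.2.1, fun a ha => (l.2.2 a ha).1⟩

theorem KBounded.le {k : ℕ} (l : KBounded k) : ∀ x ∈ intList l.1, x ≤ (k : ℤ) := by
  intro x hx
  obtain ⟨c, hc, rfl⟩ := List.mem_map.mp hx
  exact_mod_cast (l.2.2 c hc).2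

theorem KBounded.coheight_lt {k : ℕ} (l m : KBounded k) (h : l.SDom m) :
    coheight m.1 < coheight l.1 := KSchur.coheight_lt l.isPart h

theorem KBounded.sdom_trans {k : ℕ} (l m n : KBounded k) (h : l.SDom m) (h' : m.SDom n) :
    l.SDom n := h.trans h'

theorem vertexBSeq_mem_span_hallLittlewood (t : K) {k : ℕ} {γ : List ℤ}
    (hγ : ∀ x ∈ γ, x ≤ (k : ℤ)) : vertexBSeq t γ 1 ∈ Submodule.span (intPoly t)
      ((fun m : KBounded k => hallLittlewood t m.1) '' {m | Dom γ (intList m.1)}) := by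
  refine Submodule.span_mono ?_ (vertexBSeq_mem_span t k γ hγ)
  rintro _ ⟨μ, ⟨h1, h2, h3⟩, rfl⟩
  exact ⟨⟨μ, h1.1, fun a ha => ⟨h1.2 a ha, by exact_mod_cast h2 a ha⟩⟩, h3,
    hallLittlewood_eq t μ⟩

theorem kSplitPoly_sub_hallLittlewood_mem (t : K) {k : ℕ} (l : KBounded k) :
    kSplitPoly t k l.1 - hallLittlewood t l.1 ∈ Submodule.span (intPoly t)
      ((fun m : KBounded k => hallLittlewood t m.1) '' {m | l.SDom m}) := by
  rw [hallLittlewood_eq]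
  refine Submodule.span_le.mpr ?_
    (kSplitPoly_sub_word_mem t k l.1 l.2.1 fun a ha => (l.2.2 a ha).2)
  rintro _ ⟨γ, ⟨hγ, hd⟩, rfl⟩
  exact Submodule.span_mono (Set.image_mono fun m hm => hd.trans_dom hm)
    (vertexBSeq_mem_span_hallLittlewood t hγ)

theorem linearIndependent_kSplitPoly (t : K) (k : ℕ) :
    LinearIndependent K fun l : KBounded k => kSplitPoly t k l.1 := by
  refine linearIndependent_of_unitriangular (r := KBounded.SDom) KBounded.coheight_lt
    (fun l => span_intPoly_le t (kSplitPoly_sub_hallLittlewood_mem t l)) ?_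
  exact (linearIndependent_hallLittlewood t).comp (fun l : KBounded k => ⟨l.1, l.isPart⟩)
    fun l m h => Subtype.ext (congrArg (fun x : {l : List ℕ // IsPart l} => x.1) h)

theorem span_kSplitPoly (t : K) (k : ℕ) :
    Submodule.span K (Set.range fun l : KBounded k => kSplitPoly t k l.1) = LambdaK t k :=
  span_range_eq_of_unitriangular KBounded.sdom_trans KBounded.coheight_lt
    fun l => span_intPoly_le t (kSplitPoly_sub_hallLittlewood_mem t l)

theorem vertexB_mem_LambdaK (t : K) (k : ℕ) {j : ℤ} (hj : j ≤ k) {f : SymFun K}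
    (hf : f ∈ LambdaK t k) : vertexB t j f ∈ LambdaK t k := by
  refine map_mem_of_mem_span (vertexLin t j) ?_ hf
  rintro _ ⟨l, rfl⟩
  simp only [hallLittlewood_eq]
  have hb : ∀ x ∈ j :: intList l.1, x ≤ (k : ℤ) := by
    intro x hx
    rcases List.mem_cons.mp hx with rfl | hx
    · exact hj
    · exact l.le x hx
  exact Submodule.span_mono (Set.image_subset_range _ _)
    (span_intPoly_le t (vertexBSeq_mem_span_hallLittlewood t hb))

end SplitPolynomials

/-! ### The `k`-Schur functions -/

section KSchurFunctions

variable {K : Type*} [Field K] [CharZero K]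

/-- Independence of the G_m makes the chosen coefficients the only possible ones, so the projection
does not depend on the choice. -/
theorem projT_linearCombination (t : K) (k j : ℕ) (c : KBounded k →₀ K) :
    projT t k j (Finsupp.linearCombination K (fun m : KBounded k => kSplitPoly t k m.1) c) =
      Finsupp.linearCombination K (fun m : KBounded k => kSplitPoly t k m.1)
        (c.filter fun m => firstPart m.1 = j) := by
  have hex : ∃ c' : KBounded k →₀ K,
      Finsupp.linearCombination K (fun m : KBounded k => kSplitPoly t k m.1) c =
        Finsupp.linearCombination K (fun m : KBounded k => kSplitPoly t k m.1) c' := ⟨c, rfl⟩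
  have hc : hex.choose = c := (linearIndependent_kSplitPoly t k hex.choose_spec).symm
  rw [projT, dif_pos hex, hc]

/-- `projT` is a bare function with a dummy value off the span; a linear map on all of Λ agreeing
with it on `LambdaK` can be applied to spans over ℤ[t]. -/
theorem exists_projT_linearMap (t : K) (k j : ℕ) : ∃ Q : SymFun K →ₗ[K] SymFun K,
    (∀ m : KBounded k, Q (kSplitPoly t k m.1) =
      if firstPart m.1 = j then kSplitPoly t k m.1 else 0) ∧
    ∀ f ∈ LambdaK t k, projT t k j f = Q f := by
  let b := Module.Basis.span (linearIndependent_kSplitPoly t k)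
  obtain ⟨Q, hQ⟩ := LinearMap.exists_extend (b.constr K fun m : KBounded k =>
    if firstPart m.1 = j then kSplitPoly t k m.1 else 0)
  have hQG : ∀ m : KBounded k, Q (kSplitPoly t k m.1) =
      if firstPart m.1 = j then kSplitPoly t k m.1 else 0 := by
    intro m
    have h := DFunLike.congr_fun hQ (b m)
    rw [Module.Basis.constr_basis, LinearMap.comp_apply] at h
    rw [← h]
    congr 1
    exact congrArg Subtype.val
      (Module.Basis.span_apply (linearIndependent_kSplitPoly t k) m).symm
  refine ⟨Q, hQG, fun f hf => ?_⟩
  rw [← span_kSplitPoly, Finsupp.mem_span_range_iff_exists_finsupp] at hf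
  obtain ⟨c, rfl⟩ := hf
  change projT t k j (Finsupp.linearCombination K (fun m : KBounded k => kSplitPoly t k m.1) c) =
    Q (Finsupp.linearCombination K (fun m : KBounded k => kSplitPoly t k m.1) c)
  rw [projT_linearCombination]
  exact linearCombination_filter _ _ _ (fun m h => (hQG m).trans (if_pos h))
    (fun m h => (hQG m).trans (if_neg h)) c

theorem span_kSplitPoly_eq_span_hallLittlewood (t : K) (k : ℕ) (α : List ℤ) :
    Submodule.span (intPoly t) ((fun m : KBounded k => kSplitPoly t k m.1) ''
      {m | SDom α (intList m.1)}) = Submodule.span (intPoly t)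
        ((fun m : KBounded k => hallLittlewood t m.1) '' {m | SDom α (intList m.1)}) :=
  span_image_eq_of_unitriangular KBounded.sdom_trans KBounded.coheight_lt
    (fun _ _ h h' => SDom.trans h' h) (kSplitPoly_sub_hallLittlewood_mem t)

/-- The induction passes from G to H and back: B_a acts simply on Hall-Littlewood words, while the
projection acts simply on the G_m. Both families have the same ℤ[t]-span on the indices strictly
above a given word. -/
theorem kSchur_sub_kSplitPoly_mem (t : K) {k : ℕ} (l : List ℕ) (hs : l.Pairwise (· ≥ ·))
    (hk : ∀ a ∈ l, 0 < a ∧ a ≤ k) :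
    kSchur t k l - kSplitPoly t k l ∈ Submodule.span (intPoly t)
      ((fun m : KBounded k => kSplitPoly t k m.1) ''
        {m | SDom (intList l) (intList m.1) ∧ firstPart m.1 = firstPart l}) := by
  induction l with
  | nil =>
    rw [kSchur, kSplitPoly, kSplit]
    change (1 : SymFun K) - 1 ∈ _
    rw [sub_self]; exact zero_mem _
  | cons a l ih =>
    let x : KBounded k := ⟨a :: l, hs, hk⟩
    let x' : KBounded k := ⟨l, (List.pairwise_cons.mp hs).2, fun b hb => hk b (by simp [hb])⟩
    have ha : (a : ℤ) ≤ k := by exact_mod_cast (hk a (by simp)).2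
    have hT : {m : KBounded k | SDom (intList l) (intList m.1) ∧ firstPart m.1 = firstPart l} ⊆
        {m | SDom (intList l) (intList m.1)} := fun m hm => hm.1
    have h1 := Submodule.span_mono (Set.image_mono hT) (ih x'.2.1 x'.2.2)
    rw [span_kSplitPoly_eq_span_hallLittlewood t k (intList l)] at h1
    have h2 := add_mem h1 (kSplitPoly_sub_hallLittlewood_mem t x')
    rw [sub_add_sub_cancel] at h2
    -- The word (a, m) need not be a partition, but it strictly dominates (a, l) and has entries at
    -- most k, so straightening only goes higher.
    have h3 : vertexLin t a (kSchur t k l - hallLittlewood t l) ∈ Submodule.span (intPoly t)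
        ((fun m : KBounded k => hallLittlewood t m.1) ''
          {m | SDom (intList (a :: l)) (intList m.1)}) := by
      refine map_mem_of_mem_span ((vertexLin t a).restrictScalars (intPoly t)) ?_ h2
      rintro _ ⟨m, hm, rfl⟩
      have hb : ∀ x ∈ (a : ℤ) :: intList m.1, x ≤ (k : ℤ) := by
        intro x hx
        rcases List.mem_cons.mp hx with rfl | hx
        · exact ha
        · exact m.le x hx
      simp only [hallLittlewood_eq t m.1]
      exact Submodule.span_mono (Set.image_mono fun n hn => (SDom.cons (a : ℤ) hm).trans_dom hn)
        (vertexBSeq_mem_span_hallLittlewood t hb)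
    have e1 : vertexLin t a (hallLittlewood t l) = hallLittlewood t (a :: l) := by
      rw [hallLittlewood_eq, hallLittlewood_eq]; rfl
    have h4 := sub_mem h3 (kSplitPoly_sub_hallLittlewood_mem t x)
    rw [map_sub, e1, sub_sub_sub_cancel_right,
      ← span_kSplitPoly_eq_span_hallLittlewood t k (intList (a :: l))] at h4
    obtain ⟨Q, hQ, hQ'⟩ := exists_projT_linearMap t k a
    have hx : kSplitPoly t k x.1 ∈ LambdaK t k := by
      rw [← span_kSplitPoly]; exact Submodule.subset_span ⟨x, rfl⟩
    -- Ensures that the projection is not evaluated at its dummy value.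
    have hmem : vertexB t a (kSchur t k l) ∈ LambdaK t k := by
      have h5 := Submodule.span_mono (Set.image_subset_range _ _) (span_intPoly_le t h4)
      rw [span_kSplitPoly] at h5
      have h6 := add_mem h5 hx
      rwa [sub_add_cancel] at h6
    have hQx : Q (kSplitPoly t k (a :: l)) = kSplitPoly t k (a :: l) :=
      (hQ x).trans (if_pos rfl)
    have e2 : kSchur t k (a :: l) - kSplitPoly t k (a :: l) =
        Q (vertexB t a (kSchur t k l) - kSplitPoly t k (a :: l)) := by
      rw [map_sub, hQx, kSchur, hQ' _ hmem]
    rw [e2]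
    -- The condition on first parts comes solely from Q, which keeps or kills each G_m and so
    -- introduces no new coefficients.
    refine map_mem_of_mem_span (Q.restrictScalars (intPoly t)) ?_ h4
    rintro _ ⟨m, hm, rfl⟩
    rw [LinearMap.restrictScalars_apply, hQ]
    split_ifs with h
    · exact Submodule.subset_span ⟨m, ⟨hm, h⟩, rfl⟩
    · exact zero_mem _

theorem kSchur_sub_kSplitPoly_mem_span (t : K) {k : ℕ} (l : KBounded k) :
    kSchur t k l.1 - kSplitPoly t k l.1 ∈ Submodule.span K
      ((fun m : KBounded k => kSplitPoly t k m.1) '' {m | l.SDom m}) :=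
  span_intPoly_le t (Submodule.span_mono (Set.image_mono fun _ hm => hm.1)
    (kSchur_sub_kSplitPoly_mem t l.1 l.2.1 l.2.2))

theorem linearIndependent_kSchur (t : K) (k : ℕ) :
    LinearIndependent K fun l : KBounded k => kSchur t k l.1 :=
  linearIndependent_of_unitriangular (r := KBounded.SDom) KBounded.coheight_lt
    (kSchur_sub_kSplitPoly_mem_span t) (linearIndependent_kSplitPoly t k)

theorem span_kSchur (t : K) (k : ℕ) :
    Submodule.span K (Set.range fun l : KBounded k => kSchur t k l.1) = LambdaK t k :=
  (span_range_eq_of_unitriangular KBounded.sdom_trans KBounded.coheight_lt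
    (kSchur_sub_kSplitPoly_mem_span t)).trans (span_kSplitPoly t k)

end KSchurFunctions

end KSchur

end

open KSchur in
/-- The `k`-Schur functions form a basis of `Λ_t^{(k)}`. The first two clauses say that the
objects that enter the definition of the `k`-Schur functions are well defined. -/
theorem mainTheorem1 {K : Type*} [Field K] [CharZero K] (t : K) (ht : Transcendental ℚ t)
    (k : ℕ) :
    (∃ b : Module.Basis (KBounded k) K (LambdaK t k),
      ∀ l, (b l : SymFun K) = kSplitPoly t k l.1) ∧
    (∀ (j : ℤ) (f : SymFun K), j ≤ k → f ∈ LambdaK t k → vertexB t j f ∈ LambdaK t k) ∧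
    (∃ b : Module.Basis (KBounded k) K (LambdaK t k),
      ∀ l, (b l : SymFun K) = kSchur t k l.1) ∧
    (∀ l : KBounded k, ∃ u : KBounded k →₀ Polynomial ℤ,
      (∀ m ∈ u.support, DomLT l.1 m.1 ∧ firstPart m.1 = firstPart l.1) ∧
      kSchur t k l.1 = kSplitPoly t k l.1 +
        u.sum fun m c => Polynomial.aeval t c • kSplitPoly t k m.1) := by
  refine ⟨exists_basis_of_span_eq (linearIndependent_kSplitPoly t k) (span_kSplitPoly t k),
    fun j f hj hf => vertexB_mem_LambdaK t k hj hf,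
    exists_basis_of_span_eq (linearIndependent_kSchur t k) (span_kSchur t k), fun l => ?_⟩
  obtain ⟨u, hu, h⟩ := exists_polynomial_coeffs t (kSchur_sub_kSplitPoly_mem t l.1 l.2.1 l.2.2)
  exact ⟨u, fun m hm => ⟨domLT_of_sdom (hu m hm).1, (hu m hm).2⟩, (sub_eq_iff_eq_add'.mp h)⟩
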